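/- **Theorem (asymptotic normality of the Scoring Rule posterior).** Let $\mathcal X$ be a measurable space (for instance a Borel subset of $\mathbb R^d$), let $\Theta\subseteq\mathbb R^p$ be a Borel set, let $(P_\theta)_{\theta\in\Theta}$ be a family of probability distributions on $\mathcal X$, and let $S$ be a scoring rule assigning to a distribution $P$ and an observation $y\in\mathcal X$ a real number $S(P,y)$, with $(\theta,y)\mapsto S(P_\theta,y)$ measurable in each variable. Let $Y_1,Y_2,\dots$ be independent random variables with distribution $P_0$, write $\mathbf Y_n=(Y_1,\dots,Y_n)$ and $S(P,P_0)=\mathbb E_{Y\sim P_0}S(P,Y)$. Let $\pi$ be the density with respect to Lebesgue measure of a prior distribution on $\Theta$, and let the Scoring Rule posterior given $\mathbf y_n=(y_1,\dots,y_n)$ be the distribution on $\Theta$ with density $$\pi_S(\theta\mid\mathbf y_n)\propto\pi(\theta)\exp\Big\{-\sum_{i=1}^nS(P_\theta,y_i)\Big\}.$$ Consider the following assumptions. * **A1.** $S(P_\theta,P_0)$ is finite for all $\theta\in\Theta$ and has a unique minimizer $\theta^\star$ over $\Theta$; the Hessian $H_\star=\nabla^2_\theta S(P_\theta,P_0)|_{\theta=\theta^\star}$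 is positive definite. * **A2.** There is an open neighborhood $E\subseteq\mathbb R^p$ of $\theta^\star$ with $\bar E\subseteq\Theta$ such that, for all $j,k,l\in\{1,\dots,p\}$, the third partial derivative $S'''(P_\theta,y)_{jkl}=\frac{\partial^3}{\partial\theta_j\partial\theta_k\partial\theta_l}S(P_\theta,y)$ exists and is continuous in $\theta\in E$ for every $y\in\mathcal X$, is measurable in $y$ for every $\theta\in E$, and satisfies $\mathbb E_{Y\sim P_0}\sup_{\theta\in E}|S'''(P_\theta,Y)_{jkl}|<\infty$. * **A3.** For the set $E$ of A2 there is a compact $K\subseteq E$ with $\theta^\star$ in the interior of $K$ such that, with probability 1, $$\liminf_{n\to\infty}\ \inf_{\theta\in\Theta\setminus K}\frac1n\sum_{i=1}^nS(P_\theta,Y_i)>S(P_{\theta^\star},P_0).$$ * **A4.** $\pi$ is continuous at $\theta^\star$ and $\pi(\theta^\star)>0$. * **A2bis.** $\Theta$ is open, convex and bounded; the conditions on $S'''(P_\theta,y)_{jkl}$ in A2 hold with $\Theta$ in place of $E$; and for every $y$ the function $\theta\mapsto S(P_\theta,y)$ extends to a continuous function $\theta\mapsto\bar S(\theta,y)$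 on the closure $\bar\Theta$, with $\theta^\star$ still the unique minimizer over $\bar\Theta$ of the expected extended score $\theta\mapsto\mathbb E_{Y\sim P_0}\bar S(\theta,Y)$. * **A3bis.** For every $y\in\mathcal X$ the function $\theta\mapsto S(P_\theta,y)$ is convex on the convex set $\Theta$. Assume one of the following: (1) A1, A2, A3 and A4; (2) A1, A2, A3bis and A4; (3) A1, A2bis and A4. Then there are $\Theta$-valued estimators $\hat\theta^{(n)}=\hat\theta^{(n)}(\mathbf Y_n)$ (measurable functions of $\mathbf Y_n$) such that $\hat\theta^{(n)}\to\theta^\star$ almost surely as $n\to\infty$ and such that the following holds with probability 1: the posterior $\pi_S(\cdot\mid\mathbf Y_n)$ is a well-defined probability distribution for all sufficiently large $n$, and, denoting by $\pi_S^*(\cdot\mid\mathbf Y_n)$ the density of $\sqrt n\,(\theta-\hat\theta^{(n)})$ when $\theta\sim\pi_S(\cdot\mid\mathbf Y_n)$, $$\int_{\mathbb R^p}\big|\pi_S^*(s\mid\mathbf Y_n)-\mathcal N(s\mid0,H_\star^{-1})\big|\,ds\longrightarrow0\qquad(n\to\infty),$$ where $\mathcal N(\cdot\mid0,\Sigma)$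 is the density of the normal distribution on $\mathbb R^p$ with mean $0$ and covariance matrix $\Sigma$. -/

import Mathlib

open MeasureTheory ProbabilityTheory Filter Topology

noncomputable section

namespace ScoringRule

variable {p : ℕ} {𝒳 : Type*} [MeasurableSpace 𝒳]

/-- The expected score `S(P, Q) = 𝔼_{Y ∼ Q} S(P, Y)`. -/
def expectedScore (S : ProbabilityMeasure 𝒳 → 𝒳 → ℝ) (P Q : ProbabilityMeasure 𝒳) : ℝ :=
  ∫ y, S P y ∂(Q : Measure 𝒳)

/-- The `j`-th standard basis vector of `ℝ^p`. -/
def basisVec (j : Fin p) : EuclideanSpace ℝ (Fin p) := EuclideanSpace.single j (1 : ℝ)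

/-- The matrix of second partial derivatives of `g` at `θ`. -/
def hessian (g : EuclideanSpace ℝ (Fin p) → ℝ) (θ : EuclideanSpace ℝ (Fin p)) :
    Matrix (Fin p) (Fin p) ℝ :=
  Matrix.of fun j k => iteratedFDeriv ℝ 2 g θ ![basisVec j, basisVec k]

/-- The third partial derivative `∂³ g / ∂θ_j ∂θ_k ∂θ_l` at `θ`. -/
def thirdPartial (g : EuclideanSpace ℝ (Fin p) → ℝ) (j k l : Fin p)
    (θ : EuclideanSpace ℝ (Fin p)) : ℝ :=
  iteratedFDeriv ℝ 3 g θ ![basisVec j, basisVec k, basisVec l]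

/-- The density at `s` of the normal distribution on `ℝ^p` with mean `m` and (positive definite)
covariance matrix `C`. -/
def gaussianDensity (m : EuclideanSpace ℝ (Fin p)) (C : Matrix (Fin p) (Fin p) ℝ)
    (s : EuclideanSpace ℝ (Fin p)) : ℝ :=
  (Real.sqrt ((2 * Real.pi) ^ p * C.det))⁻¹ *
    Real.exp (-(1 / 2) * ((s - m).ofLp ⬝ᵥ (C⁻¹.mulVec (s - m).ofLp)))

/-- `S(P_θ, ·)` is real-valued and measurable in the observation and in the parameter
`θ ∈ Θ`, so that the posterior and the expected scores make sense. -/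
structure MeasurableScore (Θ : Set (EuclideanSpace ℝ (Fin p)))
    (S : ProbabilityMeasure 𝒳 → 𝒳 → ℝ)
    (P : EuclideanSpace ℝ (Fin p) → ProbabilityMeasure 𝒳) : Prop where
  measurable_obs : ∀ θ ∈ Θ, Measurable (S (P θ))
  measurable_param : ∀ y, Measurable fun θ : Θ => S (P θ) y

/-- `π` is (the density with respect to Lebesgue measure of) a prior distribution on `Θ`. -/
structure IsPriorDensity (Θ : Set (EuclideanSpace ℝ (Fin p)))
    (π : EuclideanSpace ℝ (Fin p) → ℝ) : Prop where
  measurable : Measurable fun θ : Θ => π θ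
  nonneg : ∀ θ ∈ Θ, 0 ≤ π θ
  lintegral_eq_one : ∫⁻ θ in Θ, ENNReal.ofReal (π θ) = 1

/-- `π(θ) exp{-∑ S(P_θ, y_i)}`. -/
def posteriorWeight (S : ProbabilityMeasure 𝒳 → 𝒳 → ℝ)
    (P : EuclideanSpace ℝ (Fin p) → ProbabilityMeasure 𝒳) (π : EuclideanSpace ℝ (Fin p) → ℝ)
    {n : ℕ} (y : Fin n → 𝒳) (θ : EuclideanSpace ℝ (Fin p)) : ℝ :=
  π θ * Real.exp (-∑ i, S (P θ) (y i))

/-- The Scoring Rule posterior given the observations `y`: the distribution on `Θ` whose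
Lebesgue density is proportional to `π(θ) exp{-∑ S(P_θ, y_i)}`. It is the zero measure if the
normalizing constant is `0` or `∞`. -/
def posterior (Θ : Set (EuclideanSpace ℝ (Fin p))) (S : ProbabilityMeasure 𝒳 → 𝒳 → ℝ)
    (P : EuclideanSpace ℝ (Fin p) → ProbabilityMeasure 𝒳) (π : EuclideanSpace ℝ (Fin p) → ℝ)
    {n : ℕ} (y : Fin n → 𝒳) : Measure (EuclideanSpace ℝ (Fin p)) :=
  (∫⁻ θ in Θ, ENNReal.ofReal (posteriorWeight S P π y θ))⁻¹ •
    (volume.restrict Θ).withDensity fun θ => ENNReal.ofReal (posteriorWeight S P π y θ)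

/-- The density of `√n (θ - c)` with respect to Lebesgue measure when `θ` follows the Scoring
Rule posterior given the `n` observations `y`. -/
def rescaledDensity (Θ : Set (EuclideanSpace ℝ (Fin p))) (S : ProbabilityMeasure 𝒳 → 𝒳 → ℝ)
    (P : EuclideanSpace ℝ (Fin p) → ProbabilityMeasure 𝒳) (π : EuclideanSpace ℝ (Fin p) → ℝ)
    {n : ℕ} (y : Fin n → 𝒳) (c s : EuclideanSpace ℝ (Fin p)) : ℝ :=
  (((posterior Θ S P π y).map fun θ => Real.sqrt n • (θ - c)).rnDeriv volume s).toReal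

/-- The first `n` observations. -/
def sample {Ω : Type*} (Y : ℕ → Ω → 𝒳) (n : ℕ) (ω : Ω) : Fin n → 𝒳 := fun i => Y i ω

/-- The expected score is finite on `Θ`, `θs` is its unique minimizer, and its Hessian at `θs`
is positive definite. -/
structure UniqueMinimizer (Θ : Set (EuclideanSpace ℝ (Fin p)))
    (S : ProbabilityMeasure 𝒳 → 𝒳 → ℝ) (P : EuclideanSpace ℝ (Fin p) → ProbabilityMeasure 𝒳)
    (P₀ : ProbabilityMeasure 𝒳) (θs : EuclideanSpace ℝ (Fin p)) : Prop where
  integrable : ∀ θ ∈ Θ, Integrable (S (P θ)) (P₀ : Measure 𝒳)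
  mem : θs ∈ Θ
  lt : ∀ θ ∈ Θ, θ ≠ θs → expectedScore S (P θs) P₀ < expectedScore S (P θ) P₀
  posDef : (hessian (fun θ => expectedScore S (P θ) P₀) θs).PosDef

/-- On the open set `U`, the third partial derivatives of `θ ↦ S(P_θ, y)` exist and are
continuous, are measurable in `y`, and their suprema over `U` are `P₀`-integrable. -/
structure ThirdOrderRegular (S : ProbabilityMeasure 𝒳 → 𝒳 → ℝ)
    (P : EuclideanSpace ℝ (Fin p) → ProbabilityMeasure 𝒳) (P₀ : ProbabilityMeasure 𝒳)
    (U : Set (EuclideanSpace ℝ (Fin p))) : Prop where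
  contDiffOn : ∀ y, ContDiffOn ℝ 3 (fun θ => S (P θ) y) U
  measurable : ∀ j k l, ∀ θ ∈ U, Measurable fun y => thirdPartial (fun θ => S (P θ) y) j k l θ
  lintegral_lt_top : ∀ j k l,
    ∫⁻ y, ⨆ θ ∈ U, ENNReal.ofReal |thirdPartial (fun θ => S (P θ) y) j k l θ|
      ∂(P₀ : Measure 𝒳) < ⊤

/-- `E` is an open neighborhood of `θs` with closure in `Θ`, on which the score has regular third
derivatives. -/
structure RegularNeighborhood (Θ : Set (EuclideanSpace ℝ (Fin p)))
    (S : ProbabilityMeasure 𝒳 → 𝒳 → ℝ) (P : EuclideanSpace ℝ (Fin p) → ProbabilityMeasure 𝒳)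
    (P₀ : ProbabilityMeasure 𝒳) (θs : EuclideanSpace ℝ (Fin p))
    (E : Set (EuclideanSpace ℝ (Fin p))) : Prop where
  isOpen : IsOpen E
  mem : θs ∈ E
  closure_subset : closure E ⊆ Θ
  regular : ThirdOrderRegular S P P₀ E

/-- Separation: there is a compact `K ⊆ E`, with `θs` in its interior, such that almost surely
`liminf_n inf_{θ ∈ Θ \ K} (1/n) ∑_{i < n} S(P_θ, Y_i) > S(P_θs, P₀)`. Infima and lower limits are
taken in the extended reals. -/
def Separated {Ω : Type*} [MeasurableSpace Ω] (ν : Measure Ω) (Y : ℕ → Ω → 𝒳)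
    (Θ : Set (EuclideanSpace ℝ (Fin p))) (S : ProbabilityMeasure 𝒳 → 𝒳 → ℝ)
    (P : EuclideanSpace ℝ (Fin p) → ProbabilityMeasure 𝒳) (P₀ : ProbabilityMeasure 𝒳)
    (θs : EuclideanSpace ℝ (Fin p)) (E : Set (EuclideanSpace ℝ (Fin p))) : Prop :=
  ∃ K : Set (EuclideanSpace ℝ (Fin p)), IsCompact K ∧ K ⊆ E ∧ θs ∈ interior K ∧
    ∀ᵐ ω ∂ν, ((expectedScore S (P θs) P₀ : ℝ) : EReal) <
      liminf (fun n : ℕ =>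
        ⨅ θ ∈ Θ \ K, (((1 / (n : ℝ)) * ∑ i : Fin n, S (P θ) (sample Y n ω i) : ℝ) : EReal)) atTop

/-- The parameter space is open, convex and bounded, the score has regular third derivatives on it
and extends continuously to its closure, and `θs` remains the unique minimizer on the closure of
the expectation of the extended score. -/
structure RegularBoundedSpace (Θ : Set (EuclideanSpace ℝ (Fin p)))
    (S : ProbabilityMeasure 𝒳 → 𝒳 → ℝ) (P : EuclideanSpace ℝ (Fin p) → ProbabilityMeasure 𝒳)
    (P₀ : ProbabilityMeasure 𝒳) (θs : EuclideanSpace ℝ (Fin p)) : Prop where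
  isOpen : IsOpen Θ
  convex : Convex ℝ Θ
  isBounded : Bornology.IsBounded Θ
  regular : ThirdOrderRegular S P P₀ Θ
  extension : ∃ Sbar : EuclideanSpace ℝ (Fin p) → 𝒳 → ℝ,
    (∀ θ ∈ Θ, ∀ y, Sbar θ y = S (P θ) y) ∧
    (∀ y, ContinuousOn (fun θ => Sbar θ y) (closure Θ)) ∧
    ∀ θ ∈ closure Θ, θ ≠ θs →
      expectedScore S (P θs) P₀ < ∫ y, Sbar θ y ∂(P₀ : Measure 𝒳)

end ScoringRule

end

/-!
The proof is a Laplace approximation of the posterior, centred at an approximate M-estimator.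

*Regularity.* Integrable suprema of the third partial derivatives mean that the Hessian of the score
is Lipschitz in the parameter with an integrable constant (`ThirdOrderRegular.exists_regularScore`).
Since the scores themselves are integrable, comparing second differences with the Hessian shows that
gradient and Hessian are integrable too, and integrating Taylor's formula shows that the Hessian of
the expected score is the expected Hessian (`RegularScore.hessian_integral`). The strong law of large
numbers, applied at the single point `θs`, then yields along almost every sample a quadratic
expansion of the empirical score `L n` that is uniform on a ball (`LocalExpansion`).

*Separation.* Under each of the three sets of assumptions, almost surely `L n` eventually exceeds
`S(P_θs, P₀)` by a positive amount, uniformly outside any neighbourhood of `θs` (`SeparatesFrom`).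
For the first and the third set this is Wald's covering argument on a compact set
(`IsIIDSample.exists_lt_sampleMean_of_isCompact`). For convex scores the quadratic growth on a small
sphere propagates outwards (`LocalExpansion.separatesFrom_of_convexOn`).

*The estimator* minimizes the total score over a closed ball around `θs` up to `1 / (n + 1)`, within a
countable dense set, which avoids any measurable selection theorem
(`exists_measurable_approx_minimizer`). Because the error in `L n` is `o(1 / n)`, a gradient step shows
that the gradient at the estimator is `o(1 / √n)`
(`LocalExpansion.tendsto_sqrt_mul_norm_grad`), so that the linear term of the expansion vanishes in
the scale `√n (θ - θhat)`. Exact minimality is never needed.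

*Laplace approximation.* The rescaled posterior weight converges in `L¹` to
`π θs * exp (-s ⬝ H s / 2)` (`tendsto_integral_abs_localWeight_sub`). Normalizing, and computing the
Gaussian integral by means of the square root of `H`, gives the normal density. The normalized weight
is the density of the rescaled posterior (`rescaledDensity_ae_eq`).
-/

namespace ScoringRule

-- needed to find the norms on iterated spaces of continuous linear maps
set_option maxSynthPendingDepth 3

/-! ### Taylor expansions with a Lipschitz Hessian -/

/-- First-order Taylor expansion with quadratic remainder. The constant `K` instead of `K / 2` comes
from using the mean value inequality on a segment. -/
theorem norm_sub_sub_apply_le_of_lipschitz_fderiv {V F : Type*} [NormedAddCommGroup V]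
    [NormedSpace ℝ V] [NormedAddCommGroup F] [NormedSpace ℝ F] {φ : V → F} {φ' : V → V →L[ℝ] F}
    {C : Set V} {K : ℝ} (hC : Convex ℝ C) (hK : 0 ≤ K)
    (h1 : ∀ θ ∈ C, HasFDerivAt φ (φ' θ) θ)
    (hL : ∀ θ ∈ C, ∀ η ∈ C, ‖φ' θ - φ' η‖ ≤ K * ‖θ - η‖) {θ η : V} (hθ : θ ∈ C) (hη : η ∈ C) :
    ‖φ θ - φ η - φ' η (θ - η)‖ ≤ K * ‖θ - η‖ ^ 2 := by
  have hs : segment ℝ η θ ⊆ C := hC.segment_subset hη hθ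
  have key := Convex.norm_image_sub_le_of_norm_hasFDerivWithin_le' (𝕜 := ℝ) (f := φ) (f' := φ')
    (φ := φ' η) (s := segment ℝ η θ) (x := η) (y := θ) (C := K * ‖θ - η‖)
    (fun x hx => (h1 x (hs hx)).hasFDerivWithinAt)
    (fun x hx => (hL x (hs hx) η hη).trans
      (mul_le_mul_of_nonneg_left (norm_sub_le_of_mem_segment hx) hK))
    (convex_segment η θ) (left_mem_segment ℝ η θ) (right_mem_segment ℝ η θ)
  rwa [mul_assoc, ← sq] at key

/-- Second-order Taylor expansion with cubic remainder, from the mean value inequality on `[0, 1]`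
for the restriction to a segment of the difference of the two sides. -/
theorem abs_taylor_two_le {V : Type*} [NormedAddCommGroup V]
    [NormedSpace ℝ V] {φ : V → ℝ} {φ' : V → V →L[ℝ] ℝ} {φ'' : V → V →L[ℝ] V →L[ℝ] ℝ}
    {C : Set V} {K : ℝ} (hC : Convex ℝ C) (hK : 0 ≤ K)
    (h1 : ∀ θ ∈ C, HasFDerivAt φ (φ' θ) θ) (h2 : ∀ θ ∈ C, HasFDerivAt φ' (φ'' θ) θ)
    (hL : ∀ θ ∈ C, ∀ η ∈ C, ‖φ'' θ - φ'' η‖ ≤ K * ‖θ - η‖) {θ η : V} (hθ : θ ∈ C) (hη : η ∈ C) :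
    |φ θ - φ η - φ' η (θ - η) - 1 / 2 * φ'' η (θ - η) (θ - η)| ≤ K * ‖θ - η‖ ^ 3 := by
  set h := θ - η with hh
  have hmem : ∀ t ∈ Set.Icc (0 : ℝ) 1, η + t • h ∈ C := fun t ht =>
    hC.add_smul_sub_mem hη hθ ht
  have hd : ∀ t ∈ Set.Icc (0 : ℝ) 1, HasDerivWithinAt
      (fun t : ℝ => φ (η + t • h) - t * φ' η h - t ^ 2 / 2 * φ'' η h h)
      (φ' (η + t • h) h - φ' η h - t * φ'' η h h) (Set.Icc 0 1) t := by
    intro t ht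
    have hl : HasDerivAt (fun t : ℝ => η + t • h) h t := by
      simpa using ((hasDerivAt_id t).smul_const h).const_add η
    have ha := (h1 _ (hmem t ht)).comp_hasDerivAt t hl
    have hb := (hasDerivAt_id t).mul_const (φ' η h)
    have hc := (((hasDerivAt_id t).pow 2).div_const 2).mul_const (φ'' η h h)
    refine (((ha.sub hb).sub hc).congr_deriv ?_).hasDerivWithinAt
    simp
  have hbd : ∀ t ∈ Set.Icc (0 : ℝ) 1,
      ‖φ' (η + t • h) h - φ' η h - t * φ'' η h h‖ ≤ K * ‖h‖ ^ 3 := by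
    intro t ht
    have h3 := norm_sub_sub_apply_le_of_lipschitz_fderiv hC hK h2 hL (hmem t ht) hη
    have h4 : φ' (η + t • h) h - φ' η h - t * φ'' η h h
        = (φ' (η + t • h) - φ' η - φ'' η (η + t • h - η)) h := by simp
    rw [h4]
    refine (ContinuousLinearMap.le_opNorm _ _).trans ?_
    have h5 : ‖η + t • h - η‖ ≤ ‖h‖ := by
      rw [add_sub_cancel_left, norm_smul, Real.norm_of_nonneg ht.1]
      exact mul_le_of_le_one_left (norm_nonneg _) ht.2
    calc _ ≤ K * ‖η + t • h - η‖ ^ 2 * ‖h‖ := by gcongr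
      _ ≤ K * ‖h‖ ^ 2 * ‖h‖ := by gcongr
      _ = K * ‖h‖ ^ 3 := by ring
  have := (convex_Icc (0 : ℝ) 1).norm_image_sub_le_of_norm_hasDerivWithin_le hd hbd
    (Set.left_mem_Icc.2 zero_le_one) (Set.right_mem_Icc.2 zero_le_one)
  simp only [one_smul, one_mul, zero_smul, add_zero, sub_zero, norm_one, mul_one, one_pow,
    Real.norm_eq_abs, zero_mul, ne_eq, OfNat.ofNat_ne_zero, not_false_eq_true, zero_pow,
    zero_div] at this
  rw [show η + h = θ by simp [hh]] at this
  convert this using 2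
  ring

/-! ### Coordinates -/

theorem norm_basisVec {p : ℕ} (j : Fin p) : ‖basisVec j‖ = 1 := by
  simp [basisVec]

theorem sum_smul_basisVec {p : ℕ} (x : EuclideanSpace ℝ (Fin p)) :
    ∑ j, x j • basisVec j = x := by
  ext i
  simp [basisVec, Finset.sum_apply, Pi.single_apply]

theorem apply_eq_sum_basisVec {p : ℕ} {F : Type*} [NormedAddCommGroup F] [NormedSpace ℝ F]
    (B : EuclideanSpace ℝ (Fin p) →L[ℝ] F) (x : EuclideanSpace ℝ (Fin p)) :
    B x = ∑ j, x j • B (basisVec j) := by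
  conv_lhs => rw [← sum_smul_basisVec x]
  simp [map_sum]

theorem opNorm_le_sum_norm_basisVec {p : ℕ} {F : Type*} [NormedAddCommGroup F] [NormedSpace ℝ F]
    (B : EuclideanSpace ℝ (Fin p) →L[ℝ] F) : ‖B‖ ≤ ∑ j, ‖B (basisVec j)‖ := by
  refine B.opNorm_le_bound (Finset.sum_nonneg fun _ _ => norm_nonneg _) fun x => ?_
  rw [apply_eq_sum_basisVec B x, Finset.sum_mul]
  refine (norm_sum_le _ _).trans (Finset.sum_le_sum fun j _ => ?_)
  rw [norm_smul, mul_comm]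
  exact mul_le_mul_of_nonneg_left (PiLp.norm_apply_le x j) (norm_nonneg _)

theorem thirdPartial_eq_fderiv {p : ℕ} (φ : EuclideanSpace ℝ (Fin p) → ℝ) (j k l : Fin p)
    (θ : EuclideanSpace ℝ (Fin p)) :
    thirdPartial φ j k l θ =
      fderiv ℝ (fderiv ℝ (fderiv ℝ φ)) θ (basisVec j) (basisVec k) (basisVec l) := by
  rw [thirdPartial, iteratedFDeriv_succ_apply_right, iteratedFDeriv_two_apply]
  rfl

theorem norm_fderiv_three_le {p : ℕ} (φ : EuclideanSpace ℝ (Fin p) → ℝ)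
    (θ : EuclideanSpace ℝ (Fin p)) :
    ‖fderiv ℝ (fderiv ℝ (fderiv ℝ φ)) θ‖ ≤ ∑ j, ∑ k, ∑ l, |thirdPartial φ j k l θ| := by
  refine (opNorm_le_sum_norm_basisVec _).trans (Finset.sum_le_sum fun j _ => ?_)
  refine (opNorm_le_sum_norm_basisVec _).trans (Finset.sum_le_sum fun k _ => ?_)
  refine (opNorm_le_sum_norm_basisVec _).trans (Finset.sum_le_sum fun l _ => ?_)
  rw [thirdPartial_eq_fderiv, Real.norm_eq_abs]

theorem hasFDerivAt_fderiv_of_contDiffOn {V : Type*} [NormedAddCommGroup V] [NormedSpace ℝ V]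
    {φ : V → ℝ} {U : Set V} (hU : IsOpen U)
    (hφ : ContDiffOn ℝ 3 φ U) {θ : V} (hθ : θ ∈ U) :
    HasFDerivAt φ (fderiv ℝ φ θ) θ ∧
    HasFDerivAt (fderiv ℝ φ) (fderiv ℝ (fderiv ℝ φ) θ) θ ∧
    HasFDerivAt (fderiv ℝ (fderiv ℝ φ)) (fderiv ℝ (fderiv ℝ (fderiv ℝ φ)) θ) θ := by
  have h0 : ContDiffAt ℝ 3 φ θ := hφ.contDiffAt (hU.mem_nhds hθ)
  have h1 : ContDiffAt ℝ 2 (fderiv ℝ φ) θ := h0.fderiv_right (by norm_num)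
  have h2 : ContDiffAt ℝ 1 (fderiv ℝ (fderiv ℝ φ)) θ := h1.fderiv_right (by norm_num)
  exact ⟨(h0.differentiableAt (by norm_num)).hasFDerivAt,
    (h1.differentiableAt (by norm_num)).hasFDerivAt,
    (h2.differentiableAt (by norm_num)).hasFDerivAt⟩

/-- A bound on all third partial derivatives is a Lipschitz constant of the Hessian. -/
theorem norm_hess_sub_le {p : ℕ} {φ : EuclideanSpace ℝ (Fin p) → ℝ}
    {U C : Set (EuclideanSpace ℝ (Fin p))} (hU : IsOpen U) (hφ : ContDiffOn ℝ 3 φ U)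
    (hC : Convex ℝ C) (hCU : C ⊆ U) {K : ℝ}
    (hK : ∀ θ ∈ U, ∑ j, ∑ k, ∑ l, |thirdPartial φ j k l θ| ≤ K)
    {θ η : EuclideanSpace ℝ (Fin p)} (hθ : θ ∈ C) (hη : η ∈ C) :
    ‖fderiv ℝ (fderiv ℝ φ) θ - fderiv ℝ (fderiv ℝ φ) η‖ ≤ K * ‖θ - η‖ :=
  hC.norm_image_sub_le_of_norm_hasFDerivWithin_le
    (fun _ hx => (hasFDerivAt_fderiv_of_contDiffOn hU hφ (hCU hx)).2.2.hasFDerivWithinAt)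
    (fun x hx => (norm_fderiv_three_le φ x).trans (hK x (hCU hx))) hη hθ

/-! ### Regular scores -/

/-- The gradient in the parameter of `f θ y`, as a continuous linear form. -/
noncomputable def grad {p : ℕ} {𝒳 : Type*} (f : EuclideanSpace ℝ (Fin p) → 𝒳 → ℝ)
    (θ : EuclideanSpace ℝ (Fin p)) (y : 𝒳) : EuclideanSpace ℝ (Fin p) →L[ℝ] ℝ :=
  fderiv ℝ (fun θ => f θ y) θ

/-- The Hessian in the parameter of `f θ y`, as a continuous bilinear form. -/
noncomputable def hess {p : ℕ} {𝒳 : Type*} (f : EuclideanSpace ℝ (Fin p) → 𝒳 → ℝ)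
    (θ : EuclideanSpace ℝ (Fin p)) (y : 𝒳) :
    EuclideanSpace ℝ (Fin p) →L[ℝ] EuclideanSpace ℝ (Fin p) →L[ℝ] ℝ :=
  fderiv ℝ (fderiv ℝ fun θ => f θ y) θ

/-- The form in which the regularity assumptions on the score are used: on the open set `U` the
function `θ ↦ f θ y` is `C³`, all `f θ` are `μ`-integrable, and for almost every `y` the Hessian is
Lipschitz on convex subsets of `U`, with a `μ`-integrable constant `G y`. -/
structure RegularScore {p : ℕ} {𝒳 : Type*} [MeasurableSpace 𝒳]
    (f : EuclideanSpace ℝ (Fin p) → 𝒳 → ℝ) (μ : Measure 𝒳) (U : Set (EuclideanSpace ℝ (Fin p)))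
    (G : 𝒳 → ℝ) : Prop where
  isOpen : IsOpen U
  contDiffOn : ∀ y, ContDiffOn ℝ 3 (fun θ => f θ y) U
  measurable : ∀ θ ∈ U, Measurable (f θ)
  integrable : ∀ θ ∈ U, Integrable (f θ) μ
  integrable_bound : Integrable G μ
  bound_nonneg : ∀ y, 0 ≤ G y
  lipschitz : ∀ᵐ y ∂μ, ∀ C ⊆ U, Convex ℝ C → ∀ θ ∈ C, ∀ η ∈ C,
    ‖hess f θ y - hess f η y‖ ≤ G y * ‖θ - η‖

/-- The supremum over an open set of a continuous function of the parameter is a supremum over a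
countable set, hence is measurable in the observation. -/
theorem measurable_iSup_of_continuousOn {V 𝒳 : Type*} [TopologicalSpace V]
    [TopologicalSpace.SeparableSpace V] [MeasurableSpace 𝒳] {U : Set V} (hU : IsOpen U)
    {g : V → 𝒳 → ENNReal} (hg : ∀ y, ContinuousOn (fun θ => g θ y) U)
    (hm : ∀ θ ∈ U, Measurable (g θ)) : Measurable fun y => ⨆ θ ∈ U, g θ y := by
  obtain ⟨D, hDc, hD⟩ := TopologicalSpace.exists_countable_dense V
  have heq : (fun y => ⨆ θ ∈ U, g θ y) = fun y => ⨆ θ ∈ U ∩ D, g θ y := by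
    ext y
    refine le_antisymm (iSup₂_le fun θ hθ => ?_)
      (biSup_mono fun θ hθ => hθ.1)
    have hcl : θ ∈ closure (U ∩ D) := hD.open_subset_closure_inter hU hθ
    have : (𝓝[U ∩ D] θ).NeBot := mem_closure_iff_nhdsWithin_neBot.1 hcl
    have ht : Tendsto (fun θ => g θ y) (𝓝[U ∩ D] θ) (𝓝 (g θ y)) :=
      (hg y θ hθ).mono_left (nhdsWithin_mono _ Set.inter_subset_left)
    refine le_of_tendsto ht ?_
    filter_upwards [self_mem_nhdsWithin] with η hη
    exact le_iSup₂ (f := fun θ (_ : θ ∈ U ∩ D) => g θ y) η hη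
  rw [heq]
  exact Measurable.biSup _ (hDc.mono Set.inter_subset_right) fun θ hθ => hm θ hθ.1

theorem continuousOn_thirdPartial {p : ℕ} {φ : EuclideanSpace ℝ (Fin p) → ℝ}
    {U : Set (EuclideanSpace ℝ (Fin p))} (hU : IsOpen U) (hφ : ContDiffOn ℝ 3 φ U)
    (j k l : Fin p) : ContinuousOn (thirdPartial φ j k l) U := by
  intro θ hθ
  refine ContinuousAt.continuousWithinAt ?_
  have h0 : ContDiffAt ℝ 3 φ θ := hφ.contDiffAt (hU.mem_nhds hθ)
  have h1 : ContDiffAt ℝ 2 (fderiv ℝ φ) θ := h0.fderiv_right (by norm_num)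
  have h2 : ContDiffAt ℝ 1 (fderiv ℝ (fderiv ℝ φ)) θ := h1.fderiv_right (by norm_num)
  have h3 : ContDiffAt ℝ 0 (fderiv ℝ (fderiv ℝ (fderiv ℝ φ))) θ := h2.fderiv_right (by norm_num)
  rw [show thirdPartial φ j k l = fun θ => fderiv ℝ (fderiv ℝ (fderiv ℝ φ)) θ (basisVec j)
    (basisVec k) (basisVec l) from funext fun θ => thirdPartial_eq_fderiv φ j k l θ]
  exact ((h3.continuousAt.clm_apply continuousAt_const).clm_apply continuousAt_const).clm_apply
    continuousAt_const

/-- The sum of the suprema of the third partial derivatives is an integrable Lipschitz constant of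
the Hessian. -/
theorem ThirdOrderRegular.exists_regularScore {p : ℕ} {𝒳 : Type*} [MeasurableSpace 𝒳]
    {S : ProbabilityMeasure 𝒳 → 𝒳 → ℝ} {P : EuclideanSpace ℝ (Fin p) → ProbabilityMeasure 𝒳}
    {P₀ : ProbabilityMeasure 𝒳} {U : Set (EuclideanSpace ℝ (Fin p))}
    (h : ThirdOrderRegular S P P₀ U) (hU : IsOpen U) (hm : ∀ θ ∈ U, Measurable (S (P θ)))
    (hi : ∀ θ ∈ U, Integrable (S (P θ)) (P₀ : Measure 𝒳)) :
    ∃ G, RegularScore (fun θ y => S (P θ) y) (P₀ : Measure 𝒳) U G := by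
  set T : Fin p → Fin p → Fin p → 𝒳 → ENNReal := fun j k l y =>
    ⨆ θ ∈ U, ENNReal.ofReal |thirdPartial (fun θ => S (P θ) y) j k l θ| with hT
  have hTm : ∀ j k l, Measurable (T j k l) := fun j k l =>
    measurable_iSup_of_continuousOn hU
      (fun y => ENNReal.continuous_ofReal.comp_continuousOn
        (continuousOn_thirdPartial hU (h.contDiffOn y) j k l).abs)
      fun θ hθ => ((h.measurable j k l θ hθ).norm).ennreal_ofReal
  have hfin : ∀ᵐ y ∂(P₀ : Measure 𝒳), ∀ j k l, T j k l y < ⊤ := by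
    simp only [ae_all_iff]
    exact fun j k l => ae_lt_top (hTm j k l) (h.lintegral_lt_top j k l).ne
  refine ⟨fun y => ∑ j, ∑ k, ∑ l, (T j k l y).toReal, hU, h.contDiffOn, hm, hi, ?_, ?_, ?_⟩
  · exact integrable_finsetSum _ fun j _ => integrable_finsetSum _ fun k _ =>
      integrable_finsetSum _ fun l _ =>
        integrable_toReal_of_lintegral_ne_top (hTm j k l).aemeasurable
          (h.lintegral_lt_top j k l).ne
  · intro y
    exact Finset.sum_nonneg fun j _ => Finset.sum_nonneg fun k _ => Finset.sum_nonneg fun l _ =>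
      ENNReal.toReal_nonneg
  · filter_upwards [hfin] with y hy C hCU hC θ hθ η hη
    refine norm_hess_sub_le hU (h.contDiffOn y) hC hCU (fun ξ hξ => ?_) hθ hη
    refine Finset.sum_le_sum fun j _ => Finset.sum_le_sum fun k _ => Finset.sum_le_sum fun l _ => ?_
    refine (ENNReal.ofReal_le_iff_le_toReal (hy j k l).ne).1 ?_
    exact le_iSup₂ (f := fun θ (_ : θ ∈ U) =>
      ENNReal.ofReal |thirdPartial (fun θ => S (P θ) y) j k l θ|) ξ hξ

/-! ### Integrability of the gradient and of the Hessian -/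

/-- A directional derivative is a limit of difference quotients, hence measurable. -/
theorem measurable_hasFDerivAt_apply {V 𝒳 : Type*} [NormedAddCommGroup V] [NormedSpace ℝ V]
    [MeasurableSpace 𝒳] {U : Set V} (hU : IsOpen U) {F : V → 𝒳 → ℝ}
    (hm : ∀ θ ∈ U, Measurable (F θ)) {θ : V} (hθ : θ ∈ U) {F' : 𝒳 → V →L[ℝ] ℝ}
    (hF : ∀ y, HasFDerivAt (fun θ => F θ y) (F' y) θ) (v : V) :
    Measurable fun y => F' y v := by
  have hc : Tendsto (fun n : ℕ => θ + ((n : ℝ))⁻¹ • v) atTop (𝓝 θ) := by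
    have := (tendsto_inv_atTop_nhds_zero_nat (𝕜 := ℝ)).smul_const v
    simpa using this.const_add θ
  obtain ⟨N, hN⟩ := eventually_atTop.1 (hc.eventually (hU.mem_nhds hθ))
  refine measurable_of_tendsto_metrizable
    (f := fun (n : ℕ) y => ((n + N : ℕ) : ℝ) * (F (θ + (((n + N : ℕ) : ℝ))⁻¹ • v) y - F θ y))
    (fun n => ((hm _ (hN _ (Nat.le_add_left _ _))).sub (hm θ hθ)).const_mul _) ?_
  rw [tendsto_pi_nhds]
  intro y
  refine (hF y).lim v (c := fun n : ℕ => ((n + N : ℕ) : ℝ)) ?_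
  refine tendsto_norm_atTop_atTop.comp ?_
  exact tendsto_natCast_atTop_atTop.comp (tendsto_add_atTop_nat N)

namespace RegularScore

variable {p : ℕ} {𝒳 : Type*} [MeasurableSpace 𝒳] {f : EuclideanSpace ℝ (Fin p) → 𝒳 → ℝ}
  {μ : Measure 𝒳} {U : Set (EuclideanSpace ℝ (Fin p))} {G : 𝒳 → ℝ}

theorem hasFDerivAt (h : RegularScore f μ U G) {θ : EuclideanSpace ℝ (Fin p)} (hθ : θ ∈ U)
    (y : 𝒳) : HasFDerivAt (fun θ => f θ y) (grad f θ y) θ :=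
  (hasFDerivAt_fderiv_of_contDiffOn h.isOpen (h.contDiffOn y) hθ).1

theorem hasFDerivAt_grad (h : RegularScore f μ U G) {θ : EuclideanSpace ℝ (Fin p)} (hθ : θ ∈ U)
    (y : 𝒳) : HasFDerivAt (fun θ => grad f θ y) (hess f θ y) θ :=
  (hasFDerivAt_fderiv_of_contDiffOn h.isOpen (h.contDiffOn y) hθ).2.1

theorem measurable_grad_apply (h : RegularScore f μ U G) {θ : EuclideanSpace ℝ (Fin p)}
    (hθ : θ ∈ U) (v : EuclideanSpace ℝ (Fin p)) : Measurable fun y => grad f θ y v :=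
  measurable_hasFDerivAt_apply h.isOpen h.measurable hθ (fun y => h.hasFDerivAt hθ y) v

theorem measurable_hess_apply (h : RegularScore f μ U G) {θ : EuclideanSpace ℝ (Fin p)}
    (hθ : θ ∈ U) (v w : EuclideanSpace ℝ (Fin p)) : Measurable fun y => hess f θ y v w := by
  refine measurable_hasFDerivAt_apply (F := fun θ y => grad f θ y w)
    (F' := fun y => (hess f θ y).flip w) h.isOpen
    (fun θ hθ => h.measurable_grad_apply hθ w) hθ (fun y => ?_) v
  exact ((ContinuousLinearMap.apply ℝ ℝ w).hasFDerivAt.comp θ (h.hasFDerivAt_grad hθ y)).congr_fderiv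
    (by ext; simp)

theorem hess_symm (h : RegularScore f μ U G) {θ : EuclideanSpace ℝ (Fin p)} (hθ : θ ∈ U)
    (y : 𝒳) (v w : EuclideanSpace ℝ (Fin p)) : hess f θ y v w = hess f θ y w v :=
  ((h.contDiffOn y).contDiffAt (h.isOpen.mem_nhds hθ)).isSymmSndFDerivAt
    (by simp; norm_num) v w

/-- The second-order Taylor expansion of the score, at almost every observation. -/
theorem ae_taylor (h : RegularScore f μ U G) : ∀ᵐ y ∂μ, ∀ C ⊆ U, Convex ℝ C → ∀ θ ∈ C, ∀ η ∈ C,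
    |f θ y - f η y - grad f η y (θ - η) - 1 / 2 * hess f η y (θ - η) (θ - η)|
        ≤ G y * ‖θ - η‖ ^ 3 ∧
      ‖grad f θ y - grad f η y - hess f η y (θ - η)‖ ≤ G y * ‖θ - η‖ ^ 2 := by
  filter_upwards [h.lipschitz] with y hy C hCU hC θ hθ η hη
  exact ⟨abs_taylor_two_le hC (h.bound_nonneg y) (fun ξ hξ => h.hasFDerivAt (hCU hξ) y)
      (fun ξ hξ => h.hasFDerivAt_grad (hCU hξ) y) (hy C hCU hC) hθ hη,
    norm_sub_sub_apply_le_of_lipschitz_fderiv hC (h.bound_nonneg y)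
      (fun ξ hξ => h.hasFDerivAt_grad (hCU hξ) y) (hy C hCU hC) hθ hη⟩

/-- The second difference `f (θ + h) + f (θ - h) - 2 f θ` is integrable and differs from the
Hessian form at `h` by at most a multiple of `G`. Homogeneity extends this to all directions. -/
theorem exists_ball_integrable_hess_grad (h : RegularScore f μ U G) {θ : EuclideanSpace ℝ (Fin p)}
    (hθ : θ ∈ U) : ∃ r > 0, Metric.ball θ r ⊆ U ∧ ∀ v ∈ Metric.ball (0 : EuclideanSpace ℝ (Fin p)) r,
      Integrable (fun y => hess f θ y v v) μ ∧ Integrable (fun y => grad f θ y v) μ := by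
  obtain ⟨r, hr, hrU⟩ := Metric.isOpen_iff.1 h.isOpen θ hθ
  refine ⟨r, hr, hrU, fun v hv => ?_⟩
  have hv' : ‖v‖ < r := by simpa using hv
  have hp : θ + v ∈ Metric.ball θ r := by simpa [Metric.mem_ball, dist_eq_norm] using hv'
  have hn : θ - v ∈ Metric.ball θ r := by simpa [Metric.mem_ball, dist_eq_norm] using hv'
  have h0 := Metric.mem_ball_self (x := θ) hr
  have hH : Integrable (fun y => hess f θ y v v) μ := by
    refine Integrable.mono' (g := fun y => |f (θ + v) y| + |f (θ - v) y| + 2 * |f θ y|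
      + 2 * (G y * ‖v‖ ^ 3)) ?_ (h.measurable_hess_apply hθ v v).aestronglyMeasurable ?_
    · exact ((((h.integrable _ (hrU hp)).abs.add (h.integrable _ (hrU hn)).abs).add
        ((h.integrable _ hθ).abs.const_mul 2)).add
        ((h.integrable_bound.mul_const _).const_mul 2))
    · filter_upwards [h.ae_taylor] with y hy
      have h1 := (hy _ hrU (convex_ball θ r) _ hp _ h0).1
      have h2 := (hy _ hrU (convex_ball θ r) _ hn _ h0).1
      simp only [add_sub_cancel_left, sub_sub_cancel_left, map_neg, neg_apply, neg_neg,
        norm_neg] at h1 h2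
      rw [Real.norm_eq_abs]
      have a1 := abs_le.1 h1
      have a2 := abs_le.1 h2
      have b1 := abs_le.1 (le_refl |f (θ + v) y|)
      have b2 := abs_le.1 (le_refl |f (θ - v) y|)
      have b3 := abs_le.1 (le_refl |f θ y|)
      rw [abs_le]
      constructor <;> linarith [a1.1, a1.2, a2.1, a2.2, b1.1, b1.2, b2.1, b2.2, b3.1, b3.2]
  refine ⟨hH, ?_⟩
  refine Integrable.mono' (g := fun y => |f (θ + v) y| + |f θ y| + |hess f θ y v v|
      + G y * ‖v‖ ^ 3) ?_ (h.measurable_grad_apply hθ v).aestronglyMeasurable ?_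
  · exact ((((h.integrable _ (hrU hp)).abs.add (h.integrable _ hθ).abs).add
        hH.abs).add (h.integrable_bound.mul_const _))
  · filter_upwards [h.ae_taylor] with y hy
    have h1 := (hy _ hrU (convex_ball θ r) _ hp _ h0).1
    simp only [add_sub_cancel_left] at h1
    rw [Real.norm_eq_abs]
    have a1 := abs_le.1 h1
    have b1 := abs_le.1 (le_refl |f (θ + v) y|)
    have b2 := abs_le.1 (le_refl |hess f θ y v v|)
    have b3 := abs_le.1 (le_refl |f θ y|)
    rw [abs_le]
    constructor <;> linarith [a1.1, a1.2, b1.1, b1.2, b2.1, b2.2, b3.1, b3.2]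

end RegularScore

theorem integrable_clm_of_basisVec {p : ℕ} {𝒳 F : Type*} [MeasurableSpace 𝒳]
    [NormedAddCommGroup F] [NormedSpace ℝ F] {μ : Measure 𝒳}
    {A : 𝒳 → EuclideanSpace ℝ (Fin p) →L[ℝ] F}
    (hA : ∀ j, Integrable (fun y => A y (basisVec j)) μ) : Integrable A μ := by
  have heq : A = fun y => ∑ j, ContinuousLinearMap.smulRightL ℝ (EuclideanSpace ℝ (Fin p)) F
      (EuclideanSpace.proj j) (A y (basisVec j)) := by
    funext y
    refine ContinuousLinearMap.ext fun x => ?_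
    rw [apply_eq_sum_basisVec (A y) x]
    simp only [sum_apply, ContinuousLinearMap.smulRightL_apply_apply]
    rfl
  rw [heq]
  exact integrable_finsetSum _ fun j _ => ContinuousLinearMap.integrable_comp _ (hA j)

namespace RegularScore

variable {p : ℕ} {𝒳 : Type*} [MeasurableSpace 𝒳] {f : EuclideanSpace ℝ (Fin p) → 𝒳 → ℝ}
  {μ : Measure 𝒳} {U : Set (EuclideanSpace ℝ (Fin p))} {G : 𝒳 → ℝ}

theorem integrable_grad (h : RegularScore f μ U G) {θ : EuclideanSpace ℝ (Fin p)} (hθ : θ ∈ U) :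
    Integrable (grad f θ) μ := by
  obtain ⟨r, hr, -, hv⟩ := h.exists_ball_integrable_hess_grad hθ
  refine integrable_clm_of_basisVec fun j => ?_
  have := (hv ((r / 2) • basisVec j) (by
    rw [mem_ball_zero_iff, norm_smul, norm_basisVec, mul_one, Real.norm_of_nonneg (by positivity)]
    linarith)).2.const_mul (r / 2)⁻¹
  refine this.congr (Eventually.of_forall fun y => ?_)
  simp only [map_smul, smul_eq_mul]
  field_simp

theorem integrable_hess (h : RegularScore f μ U G) {θ : EuclideanSpace ℝ (Fin p)} (hθ : θ ∈ U) :
    Integrable (hess f θ) μ := by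
  obtain ⟨r, hr, -, hv⟩ := h.exists_ball_integrable_hess_grad hθ
  have hself : ∀ v, Integrable (fun y => hess f θ y v v) μ := by
    intro v
    set t := r / 2 / (‖v‖ + 1) with ht
    have htpos : 0 < t := by positivity
    have := (hv (t • v) (by
      rw [mem_ball_zero_iff, norm_smul, Real.norm_of_nonneg htpos.le, ht, div_mul_eq_mul_div,
        div_lt_iff₀ (by positivity)]
      nlinarith [norm_nonneg v])).1.const_mul (t⁻¹ * t⁻¹)
    refine this.congr (Eventually.of_forall fun y => ?_)
    simp only [map_smul, smul_eq_mul, smul_apply]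
    field_simp
  refine integrable_clm_of_basisVec fun j => integrable_clm_of_basisVec fun k => ?_
  -- polarization, by the symmetry of the Hessian
  have := (((hself (basisVec j + basisVec k)).sub (hself (basisVec j))).sub
    (hself (basisVec k))).const_mul (1 / 2)
  refine this.congr (Eventually.of_forall fun y => ?_)
  simp only [Pi.sub_apply, map_add, add_apply,
    h.hess_symm hθ y (basisVec k) (basisVec j)]
  ring

end RegularScore

/-! ### Derivatives of the expected score -/

theorem hasFDerivAt_of_norm_le_sq {V F : Type*} [NormedAddCommGroup V] [NormedSpace ℝ V]
    [NormedAddCommGroup F] [NormedSpace ℝ F] {φ : V → F} {A : V →L[ℝ] F} {θ : V} {r K : ℝ}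
    (hr : 0 < r) (hb : ∀ η ∈ Metric.ball θ r, ‖φ η - φ θ - A (η - θ)‖ ≤ K * ‖η - θ‖ ^ 2) :
    HasFDerivAt φ A θ := by
  rw [hasFDerivAt_iff_isLittleO]
  refine Asymptotics.IsBigO.trans_isLittleO (g := fun η => ‖η - θ‖ ^ 2) ?_
    (Asymptotics.isLittleO_pow_sub_sub θ one_lt_two)
  refine Asymptotics.IsBigO.of_bound K ?_
  filter_upwards [Metric.ball_mem_nhds θ hr] with η hη
  simpa using hb η hη

namespace RegularScore

variable {p : ℕ} {𝒳 : Type*} [MeasurableSpace 𝒳] {f : EuclideanSpace ℝ (Fin p) → 𝒳 → ℝ}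
  {μ : Measure 𝒳} {U : Set (EuclideanSpace ℝ (Fin p))} {G : 𝒳 → ℝ}

theorem hasFDerivAt_integral (h : RegularScore f μ U G) {θ : EuclideanSpace ℝ (Fin p)}
    (hθ : θ ∈ U) : HasFDerivAt (fun θ => ∫ y, f θ y ∂μ) (∫ y, grad f θ y ∂μ) θ := by
  obtain ⟨r, hr, hrU⟩ := Metric.isOpen_iff.1 h.isOpen θ hθ
  refine hasFDerivAt_of_norm_le_sq (K := 1 / 2 * (∫ y, ‖hess f θ y‖ ∂μ) + (∫ y, G y ∂μ) * r) hr ?_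
  intro η hη
  have hηr : ‖η - θ‖ < r := by simpa [dist_eq_norm] using hη
  have e : (∫ y, f η y ∂μ) - (∫ y, f θ y ∂μ) - (∫ y, grad f θ y ∂μ) (η - θ)
      = ∫ y, (f η y - f θ y - grad f θ y (η - θ)) ∂μ := by
    rw [integral_sub, integral_sub, ContinuousLinearMap.integral_apply (h.integrable_grad hθ)]
    · exact h.integrable _ (hrU hη)
    · exact h.integrable _ hθ
    · exact (h.integrable _ (hrU hη)).sub (h.integrable _ hθ)
    · exact (h.integrable_grad hθ).apply_continuousLinearMap _
  rw [e]
  refine (norm_integral_le_of_norm_le (g := fun y => 1 / 2 * ‖hess f θ y‖ * ‖η - θ‖ ^ 2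
    + G y * r * ‖η - θ‖ ^ 2) ?_ ?_).trans (le_of_eq ?_)
  · exact (((h.integrable_hess hθ).norm.const_mul _).mul_const _).add
      ((h.integrable_bound.mul_const _).mul_const _)
  · filter_upwards [h.ae_taylor] with y hy
    have h1 := (hy _ hrU (convex_ball θ r) _ hη _ (Metric.mem_ball_self hr)).1
    have h2 : |hess f θ y (η - θ) (η - θ)| ≤ ‖hess f θ y‖ * ‖η - θ‖ * ‖η - θ‖ :=
      (hess f θ y).le_opNorm₂ _ _
    have h3 : G y * ‖η - θ‖ ^ 3 ≤ G y * r * ‖η - θ‖ ^ 2 := by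
      have : ‖η - θ‖ ^ 3 ≤ r * ‖η - θ‖ ^ 2 := by
        rw [pow_succ, mul_comm]; gcongr
      calc _ ≤ G y * (r * ‖η - θ‖ ^ 2) := mul_le_mul_of_nonneg_left this (h.bound_nonneg y)
        _ = _ := by ring
    rw [Real.norm_eq_abs]
    rw [abs_le] at h1 h2 ⊢
    constructor <;> nlinarith [h1.1, h1.2, h2.1, h2.2, h3]
  · rw [integral_add, integral_mul_const, integral_mul_const, integral_const_mul,
      integral_mul_const]
    · ring
    · exact ((h.integrable_hess hθ).norm.const_mul _).mul_const _
    · exact (h.integrable_bound.mul_const _).mul_const _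

theorem hasFDerivAt_integral_grad (h : RegularScore f μ U G) {θ : EuclideanSpace ℝ (Fin p)}
    (hθ : θ ∈ U) :
    HasFDerivAt (fun θ => ∫ y, grad f θ y ∂μ) (∫ y, hess f θ y ∂μ) θ := by
  obtain ⟨r, hr, hrU⟩ := Metric.isOpen_iff.1 h.isOpen θ hθ
  refine hasFDerivAt_of_norm_le_sq (K := ∫ y, G y ∂μ) hr ?_
  intro η hη
  have e : (∫ y, grad f η y ∂μ) - (∫ y, grad f θ y ∂μ) - (∫ y, hess f θ y ∂μ) (η - θ)
      = ∫ y, (grad f η y - grad f θ y - hess f θ y (η - θ)) ∂μ := by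
    rw [integral_sub, integral_sub, ContinuousLinearMap.integral_apply (h.integrable_hess hθ)]
    · exact h.integrable_grad (hrU hη)
    · exact h.integrable_grad hθ
    · exact (h.integrable_grad (hrU hη)).sub (h.integrable_grad hθ)
    · exact (h.integrable_hess hθ).apply_continuousLinearMap (η - θ)
  rw [e, ← integral_mul_const]
  refine norm_integral_le_of_norm_le (h.integrable_bound.mul_const _) ?_
  filter_upwards [h.ae_taylor] with y hy
  exact (hy _ hrU (convex_ball θ r) _ hη _ (Metric.mem_ball_self hr)).2

/-- Differentiation under the integral sign, twice: the Hessian of the expected score is the expected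
Hessian of the score. -/
theorem hessian_integral (h : RegularScore f μ U G) {θ : EuclideanSpace ℝ (Fin p)} (hθ : θ ∈ U)
    (j k : Fin p) :
    hessian (fun θ => ∫ y, f θ y ∂μ) θ j k = (∫ y, hess f θ y ∂μ) (basisVec j) (basisVec k) := by
  have he : fderiv ℝ (fun θ => ∫ y, f θ y ∂μ) =ᶠ[𝓝 θ] fun θ => ∫ y, grad f θ y ∂μ := by
    filter_upwards [h.isOpen.mem_nhds hθ] with η hη using (h.hasFDerivAt_integral hη).fderiv
  rw [hessian, Matrix.of_apply, iteratedFDeriv_two_apply, he.fderiv_eq,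
    (h.hasFDerivAt_integral_grad hθ).fderiv]
  rfl

end RegularScore

/-! ### Sample means and the law of large numbers -/

/-- The mean of `A` over the first `n` terms of the sequence of observations `y`. -/
noncomputable def sampleMean {𝒳 F : Type*} [AddCommGroup F] [Module ℝ F] (A : 𝒳 → F) (y : ℕ → 𝒳)
    (n : ℕ) : F :=
  (n : ℝ)⁻¹ • ∑ i ∈ Finset.range n, A (y i)

section SampleMean

variable {𝒳 F : Type*} [NormedAddCommGroup F] [NormedSpace ℝ F]

theorem sampleMean_sub (A B : 𝒳 → F) (y : ℕ → 𝒳) (n : ℕ) :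
    sampleMean (fun x => A x - B x) y n = sampleMean A y n - sampleMean B y n := by
  simp [sampleMean, smul_sub]

theorem sampleMean_add (A B : 𝒳 → F) (y : ℕ → 𝒳) (n : ℕ) :
    sampleMean (fun x => A x + B x) y n = sampleMean A y n + sampleMean B y n := by
  simp [sampleMean, Finset.sum_add_distrib]

theorem sampleMean_clm_apply {F' : Type*} [NormedAddCommGroup F'] [NormedSpace ℝ F']
    (A : 𝒳 → F →L[ℝ] F') (v : F) (y : ℕ → 𝒳) (n : ℕ) :
    sampleMean (fun x => A x v) y n = sampleMean A y n v := by
  simp [sampleMean, sum_apply]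

theorem sampleMean_const_mul (c : ℝ) (A : 𝒳 → ℝ) (y : ℕ → 𝒳) (n : ℕ) :
    sampleMean (fun x => c * A x) y n = c * sampleMean A y n := by
  simp only [sampleMean, smul_eq_mul, ← Finset.mul_sum]; ring

theorem sampleMean_mul_const (c : ℝ) (A : 𝒳 → ℝ) (y : ℕ → 𝒳) (n : ℕ) :
    sampleMean (fun x => A x * c) y n = sampleMean A y n * c := by
  simp only [sampleMean, smul_eq_mul, ← Finset.sum_mul]; ring

theorem sampleMean_mono {A B : 𝒳 → ℝ} {y : ℕ → 𝒳} (h : ∀ i, A (y i) ≤ B (y i)) (n : ℕ) :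
    sampleMean A y n ≤ sampleMean B y n := by
  simp only [sampleMean, smul_eq_mul]
  exact mul_le_mul_of_nonneg_left (Finset.sum_le_sum fun i _ => h i) (by positivity)

theorem norm_sampleMean_le {A : 𝒳 → F} {B : 𝒳 → ℝ} {y : ℕ → 𝒳} (h : ∀ i, ‖A (y i)‖ ≤ B (y i))
    (n : ℕ) : ‖sampleMean A y n‖ ≤ sampleMean B y n := by
  rw [sampleMean, norm_smul, Real.norm_of_nonneg (by positivity)]
  exact mul_le_mul_of_nonneg_left
    ((norm_sum_le _ _).trans (Finset.sum_le_sum fun i _ => h i)) (by positivity)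

end SampleMean

/-- `Y` is a sequence of independent observations with law `μ`. -/
structure IsIIDSample {𝒳 Ω : Type*} [MeasurableSpace 𝒳] [MeasurableSpace Ω] (Y : ℕ → Ω → 𝒳)
    (ν : Measure Ω) (μ : Measure 𝒳) : Prop where
  measurable : ∀ i, Measurable (Y i)
  law : ∀ i, ν.map (Y i) = μ
  indep : iIndepFun Y ν

namespace IsIIDSample

variable {𝒳 Ω : Type*} [MeasurableSpace 𝒳] [MeasurableSpace Ω] {Y : ℕ → Ω → 𝒳}
    {ν : Measure Ω} {μ : Measure 𝒳}

theorem ae_forall (hY : IsIIDSample Y ν μ) {q : 𝒳 → Prop} (hq : ∀ᵐ y ∂μ, q y) :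
    ∀ᵐ ω ∂ν, ∀ i, q (Y i ω) := by
  rw [ae_all_iff]
  intro i
  rw [← hY.law i] at hq
  exact ae_of_ae_map (hY.measurable i).aemeasurable hq

/-- The strong law of large numbers. Integrability alone suffices: `A` is replaced by a measurable
function which agrees with it at almost every observation. -/
theorem strong_law (hY : IsIIDSample Y ν μ) {F : Type*} [NormedAddCommGroup F] [NormedSpace ℝ F]
    [CompleteSpace F] {A : 𝒳 → F} (hA : Integrable A μ) :
    ∀ᵐ ω ∂ν, Tendsto (fun n => sampleMean A (fun i => Y i ω) n) atTop (𝓝 (∫ y, A y ∂μ)) := by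
  borelize F
  have hsm : StronglyMeasurable (hA.1.mk A) := hA.1.stronglyMeasurable_mk
  have hBi : Integrable (hA.1.mk A) μ := hA.congr hA.1.ae_eq_mk
  have hAB : ∀ᵐ y ∂μ, A y = hA.1.mk A y := hA.1.ae_eq_mk
  rw [integral_congr_ae hAB]
  generalize hA.1.mk A = B at hsm hBi hAB
  have hint : Integrable (fun ω => B (Y 0 ω)) ν := by
    rw [← hY.law 0] at hBi
    exact hBi.comp_measurable (hY.measurable 0)
  have key := strong_law_ae (fun i ω => B (Y i ω)) hint
    (fun i j hij => (hY.indep.indepFun hij).comp hsm.measurable hsm.measurable)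
    (fun i => ⟨(hsm.measurable.comp (hY.measurable i)).aemeasurable,
      (hsm.measurable.comp (hY.measurable 0)).aemeasurable, by
        rw [show (fun ω => B (Y i ω)) = B ∘ Y i from rfl, show (fun ω => B (Y 0 ω)) = B ∘ Y 0
          from rfl, ← Measure.map_map hsm.measurable (hY.measurable i),
          ← Measure.map_map hsm.measurable (hY.measurable 0), hY.law, hY.law]⟩)
  have hlim : ∫ ω, B (Y 0 ω) ∂ν = ∫ y, B y ∂μ := by
    rw [← hY.law 0]
    exact (integral_map (hY.measurable 0).aemeasurable hsm.aestronglyMeasurable).symm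
  rw [hlim] at key
  filter_upwards [key, hY.ae_forall hAB] with ω hω heq
  simpa only [sampleMean, heq] using hω

end IsIIDSample

/-! ### Local quadratic expansions of the empirical score -/

/-- A sequence of functions `L n` with a uniform second-order expansion on the ball of radius `r`
around `θs`: `g n` and `H n` stand for the gradient and the Hessian of `L n`, `κ n` for a Lipschitz
constant of `H n`. At `θs` the values converge to `c`, the gradients to `0` and the Hessians
to `H₀`. -/
structure LocalExpansion {V : Type*} [NormedAddCommGroup V] [NormedSpace ℝ V] (L : ℕ → V → ℝ)
    (g : ℕ → V → V →L[ℝ] ℝ) (H : ℕ → V → V →L[ℝ] V →L[ℝ] ℝ) (κ : ℕ → ℝ) (θs : V) (r c : ℝ)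
    (H₀ : V →L[ℝ] V →L[ℝ] ℝ) (κ₀ : ℝ) : Prop where
  radius_pos : 0 < r
  taylor_two : ∀ n, ∀ θ ∈ Metric.ball θs r, ∀ η ∈ Metric.ball θs r,
    |L n θ - L n η - g n η (θ - η) - 1 / 2 * H n η (θ - η) (θ - η)| ≤ κ n * ‖θ - η‖ ^ 3
  taylor_one : ∀ n, ∀ θ ∈ Metric.ball θs r, ∀ η ∈ Metric.ball θs r,
    ‖g n θ - g n η - H n η (θ - η)‖ ≤ κ n * ‖θ - η‖ ^ 2
  lipschitz : ∀ n, ∀ θ ∈ Metric.ball θs r, ∀ η ∈ Metric.ball θs r,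
    ‖H n θ - H n η‖ ≤ κ n * ‖θ - η‖
  bound_nonneg : ∀ n, 0 ≤ κ n
  tendsto_value : Tendsto (fun n => L n θs) atTop (𝓝 c)
  tendsto_grad : Tendsto (fun n => g n θs) atTop (𝓝 0)
  tendsto_hess : Tendsto (fun n => H n θs) atTop (𝓝 H₀)
  tendsto_bound : Tendsto κ atTop (𝓝 κ₀)

namespace LocalExpansion

variable {V : Type*} [NormedAddCommGroup V] [NormedSpace ℝ V] {L : ℕ → V → ℝ}
    {g : ℕ → V → V →L[ℝ] ℝ} {H : ℕ → V → V →L[ℝ] V →L[ℝ] ℝ} {κ : ℕ → ℝ} {θs : V} {r c : ℝ}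
    {H₀ : V →L[ℝ] V →L[ℝ] ℝ} {κ₀ : ℝ}

theorem tendsto_hess_of_tendsto (h : LocalExpansion L g H κ θs r c H₀ κ₀) {u : ℕ → V}
    (hu : Tendsto u atTop (𝓝 θs)) : Tendsto (fun n => H n (u n)) atTop (𝓝 H₀) := by
  have h0 : Tendsto (fun n => κ n * ‖u n - θs‖) atTop (𝓝 0) := by
    simpa using h.tendsto_bound.mul (tendsto_iff_norm_sub_tendsto_zero.1 hu)
  have h1 : Tendsto (fun n => H n (u n) - H n θs) atTop (𝓝 0) := by
    refine squeeze_zero_norm' ?_ h0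
    filter_upwards [hu.eventually (Metric.ball_mem_nhds θs h.radius_pos)] with n hn
    exact h.lipschitz n _ hn _ (Metric.mem_ball_self h.radius_pos)
  simpa using h1.add h.tendsto_hess

theorem tendsto_grad_of_tendsto (h : LocalExpansion L g H κ θs r c H₀ κ₀) {u : ℕ → V}
    (hu : Tendsto u atTop (𝓝 θs)) : Tendsto (fun n => g n (u n)) atTop (𝓝 0) := by
  have hd := tendsto_iff_norm_sub_tendsto_zero.1 hu
  have h0 : Tendsto (fun n => κ n * ‖u n - θs‖ ^ 2) atTop (𝓝 0) := by
    simpa using h.tendsto_bound.mul (hd.pow 2)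
  have h1 : Tendsto (fun n => g n (u n) - g n θs - H n θs (u n - θs)) atTop (𝓝 0) := by
    refine squeeze_zero_norm' ?_ h0
    filter_upwards [hu.eventually (Metric.ball_mem_nhds θs h.radius_pos)] with n hn
    exact h.taylor_one n _ hn _ (Metric.mem_ball_self h.radius_pos)
  have h2 : Tendsto (fun n => H n θs (u n - θs)) atTop (𝓝 0) := by
    have : Tendsto (fun n => u n - θs) atTop (𝓝 0) := by simpa using hu.sub_const θs
    simpa [Function.comp_def] using (isBoundedBilinearMap_apply.continuous.tendsto (H₀, (0 : V))).comp
      (h.tendsto_hess.prodMk_nhds this)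
  simpa using (h1.add h2).add h.tendsto_grad

/-- Positive definiteness of the limiting Hessian gives quadratic growth, uniformly in `n`, on a
fixed ball around centres that converge to `θs`. -/
theorem exists_quadratic_growth (h : LocalExpansion L g H κ θs r c H₀ κ₀) {lam : ℝ}
    (hlam : 0 < lam) (hH : ∀ v, lam * ‖v‖ ^ 2 ≤ H₀ v v) {u : ℕ → V}
    (hu : Tendsto u atTop (𝓝 θs)) : ∃ ε > 0, ∀ᶠ n in atTop, ∀ v, ‖v‖ ≤ ε →
      u n + v ∈ Metric.ball θs r ∧
      lam / 4 * ‖v‖ ^ 2 - ‖g n (u n)‖ * ‖v‖ ≤ L n (u n + v) - L n (u n) := by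
  have hκ₀ : 0 ≤ κ₀ := ge_of_tendsto' h.tendsto_bound h.bound_nonneg
  have hr := h.radius_pos
  refine ⟨min (r / 4) (lam / (8 * (κ₀ + 1))), by positivity, ?_⟩
  have e1 := hu.eventually (Metric.ball_mem_nhds θs (half_pos hr))
  have e2 := (h.tendsto_hess_of_tendsto hu).eventually
    (Metric.ball_mem_nhds H₀ (show 0 < lam / 4 by positivity))
  have e3 := h.tendsto_bound.eventually_lt_const (lt_add_one κ₀)
  filter_upwards [e1, e2, e3] with n h1 h2 h3 v hv
  rw [dist_eq_norm] at h1 h2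
  have hv1 : ‖v‖ ≤ r / 4 := hv.trans (min_le_left _ _)
  have hv2 : (κ₀ + 1) * ‖v‖ ≤ lam / 8 := by
    have := hv.trans (min_le_right _ _)
    rw [le_div_iff₀ (by positivity)] at this
    linarith
  have m1 : u n + v ∈ Metric.ball θs r := by
    rw [mem_ball_iff_norm, add_sub_right_comm]
    linarith [norm_add_le (u n - θs) v]
  refine ⟨m1, ?_⟩
  have m0 : u n ∈ Metric.ball θs r := by rw [mem_ball_iff_norm]; linarith
  have ht := (abs_le.1 (h.taylor_two n _ m1 _ m0)).1
  rw [add_sub_cancel_left] at ht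
  have hg : -(‖g n (u n)‖ * ‖v‖) ≤ g n (u n) v :=
    neg_le_of_abs_le ((g n (u n)).le_opNorm v)
  have hHv : -(lam / 4 * ‖v‖ * ‖v‖) ≤ H n (u n) v v - H₀ v v := by
    refine neg_le_of_abs_le ?_
    have := (H n (u n) - H₀).le_opNorm₂ v v
    simp only [sub_apply, Real.norm_eq_abs] at this
    refine this.trans ?_
    gcongr
  have hk : κ n * ‖v‖ ^ 3 ≤ lam / 8 * ‖v‖ ^ 2 := by
    calc κ n * ‖v‖ ^ 3 ≤ (κ₀ + 1) * ‖v‖ ^ 3 := by gcongr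
      _ = ((κ₀ + 1) * ‖v‖) * ‖v‖ ^ 2 := by ring
      _ ≤ _ := by gcongr
  have := hH v
  nlinarith

end LocalExpansion

/-- The law of large numbers for the score, its gradient, its Hessian and the Lipschitz constant of
the Hessian gives a local expansion of the empirical score along almost every sample. -/
theorem RegularScore.exists_localExpansion {p : ℕ} {𝒳 Ω : Type*} [MeasurableSpace 𝒳]
    [MeasurableSpace Ω] {f : EuclideanSpace ℝ (Fin p) → 𝒳 → ℝ}
    {μ : Measure 𝒳} {U : Set (EuclideanSpace ℝ (Fin p))} {G : 𝒳 → ℝ} (h : RegularScore f μ U G)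
    {Y : ℕ → Ω → 𝒳} {ν : Measure Ω} (hY : IsIIDSample Y ν μ) {θs : EuclideanSpace ℝ (Fin p)}
    {r : ℝ} (hr : 0 < r) (hrU : Metric.ball θs r ⊆ U) (hθs : ∫ y, grad f θs y ∂μ = 0) :
    ∀ᵐ ω ∂ν, LocalExpansion (fun n θ => sampleMean (f θ) (fun i => Y i ω) n)
      (fun n θ => sampleMean (grad f θ) (fun i => Y i ω) n)
      (fun n θ => sampleMean (hess f θ) (fun i => Y i ω) n)
      (sampleMean G (fun i => Y i ω)) θs r (∫ y, f θs y ∂μ) (∫ y, hess f θs y ∂μ)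
      (∫ y, G y ∂μ) := by
  have hs : θs ∈ U := hrU (Metric.mem_ball_self hr)
  filter_upwards [hY.strong_law (h.integrable _ hs), hY.strong_law (h.integrable_grad hs),
    hY.strong_law (h.integrable_hess hs), hY.strong_law h.integrable_bound,
    hY.ae_forall h.ae_taylor, hY.ae_forall h.lipschitz] with ω l1 l2 l3 l4 hT hL
  have hb := convex_ball θs r
  refine ⟨hr, fun n θ hθ η hη => ?_, fun n θ hθ η hη => ?_, fun n θ hθ η hη => ?_, fun n => ?_,
    l1, hθs ▸ l2, l3, l4⟩
  · rw [← sampleMean_mul_const, ← sampleMean_clm_apply, ← sampleMean_clm_apply,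
      ← sampleMean_clm_apply, ← sampleMean_const_mul, ← sampleMean_sub, ← sampleMean_sub,
      ← sampleMean_sub, ← Real.norm_eq_abs]
    exact norm_sampleMean_le (fun i => (hT i _ hrU hb _ hθ _ hη).1) n
  · rw [← sampleMean_mul_const, ← sampleMean_clm_apply, ← sampleMean_sub, ← sampleMean_sub]
    exact norm_sampleMean_le (fun i => (hT i _ hrU hb _ hθ _ hη).2) n
  · rw [← sampleMean_mul_const, ← sampleMean_sub]
    exact norm_sampleMean_le (fun i => hL i _ hrU hb _ hθ _ hη) n
  · have := sampleMean_mono (A := fun _ => (0 : ℝ)) (B := G) (y := fun i => Y i ω)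
      (fun i => h.bound_nonneg _) n
    simpa [sampleMean] using this

/-! ### Separation of the minimizer -/

/-- Outside every neighbourhood of `θs`, the functions `L n` eventually exceed `c` uniformly on
`Θ`. -/
def SeparatesFrom {V : Type*} [NormedAddCommGroup V] (L : ℕ → V → ℝ) (Θ : Set V) (θs : V)
    (c : ℝ) : Prop :=
  ∀ ε > 0, ∃ η > 0, ∀ᶠ n in atTop, ∀ θ ∈ Θ, ε ≤ ‖θ - θs‖ → c + η ≤ L n θ

/-- Wald's covering argument: if every point of the compact set `C` has a neighbourhood on which the
score is bounded below by an integrable function of mean larger than `c`, then the empirical score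
eventually exceeds `c` uniformly on `C`. -/
theorem IsIIDSample.exists_lt_sampleMean_of_isCompact {V 𝒳 Ω : Type*} [TopologicalSpace V]
    [MeasurableSpace 𝒳] [MeasurableSpace Ω] {Y : ℕ → Ω → 𝒳} {ν : Measure Ω} {μ : Measure 𝒳}
    (hY : IsIIDSample Y ν μ) {f : V → 𝒳 → ℝ} {A C : Set V} (hC : IsCompact C) {c : ℝ}
    (hloc : ∀ θ₀ ∈ C, ∃ N ∈ 𝓝 θ₀, ∃ m : 𝒳 → ℝ, Integrable m μ ∧ c < ∫ y, m y ∂μ ∧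
      ∀ᵐ y ∂μ, ∀ θ ∈ N ∩ A, m y ≤ f θ y) :
    ∃ η > 0, ∀ᵐ ω ∂ν, ∀ᶠ n in atTop, ∀ θ ∈ C ∩ A,
      c + η ≤ sampleMean (f θ) (fun i => Y i ω) n := by
  refine hC.induction_on (p := fun s => ∃ η > 0, ∀ᵐ ω ∂ν, ∀ᶠ n in atTop, ∀ θ ∈ s ∩ A,
      c + η ≤ sampleMean (f θ) (fun i => Y i ω) n) ⟨1, one_pos, by simp⟩ ?_ ?_ ?_
  · rintro s t hst ⟨η, hη, h⟩
    refine ⟨η, hη, ?_⟩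
    filter_upwards [h] with ω hω
    filter_upwards [hω] with n hn θ hθ using hn θ ⟨hst hθ.1, hθ.2⟩
  · rintro s t ⟨η₁, hη₁, h₁⟩ ⟨η₂, hη₂, h₂⟩
    refine ⟨min η₁ η₂, lt_min hη₁ hη₂, ?_⟩
    filter_upwards [h₁, h₂] with ω hω₁ hω₂
    filter_upwards [hω₁, hω₂] with n hn₁ hn₂ θ hθ
    rcases hθ with ⟨hs | ht, hA⟩
    · linarith [hn₁ θ ⟨hs, hA⟩, min_le_left η₁ η₂]
    · linarith [hn₂ θ ⟨ht, hA⟩, min_le_right η₁ η₂]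
  · intro θ₀ hθ₀
    obtain ⟨N, hN, m, hm, hcm, hle⟩ := hloc θ₀ hθ₀
    refine ⟨N, mem_nhdsWithin_of_mem_nhds hN, ((∫ y, m y ∂μ) - c) / 2, by linarith, ?_⟩
    filter_upwards [hY.strong_law hm, hY.ae_forall hle] with ω hω hleω
    filter_upwards [hω.eventually_const_lt
      (show c + ((∫ y, m y ∂μ) - c) / 2 < ∫ y, m y ∂μ by linarith)] with n hn θ hθ
    exact hn.le.trans (sampleMean_mono (fun i => hleω i θ hθ) n)

/-- On a bounded convex subset of `U` the score is Lipschitz, with an integrable constant. -/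
theorem RegularScore.exists_integrable_lipschitz {p : ℕ} {𝒳 : Type*} [MeasurableSpace 𝒳]
    {f : EuclideanSpace ℝ (Fin p) → 𝒳 → ℝ} {μ : Measure 𝒳} {U : Set (EuclideanSpace ℝ (Fin p))}
    {G : 𝒳 → ℝ} (h : RegularScore f μ U G) {C : Set (EuclideanSpace ℝ (Fin p))} (hCU : C ⊆ U)
    (hC : Convex ℝ C) {θ₀ : EuclideanSpace ℝ (Fin p)} (hθ₀ : θ₀ ∈ C) {D : ℝ}
    (hD : ∀ θ ∈ C, ‖θ - θ₀‖ ≤ D) :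
    ∃ K : 𝒳 → ℝ, Integrable K μ ∧ (∀ y, 0 ≤ K y) ∧
      ∀ᵐ y ∂μ, ∀ θ ∈ C, ∀ η ∈ C, |f θ y - f η y| ≤ K y * ‖θ - η‖ := by
  have hD0 : 0 ≤ D := (norm_nonneg _).trans (hD θ₀ hθ₀)
  refine ⟨fun y => ‖grad f θ₀ y‖ + ‖hess f θ₀ y‖ * D + G y * D ^ 2, ?_, fun y => ?_, ?_⟩
  · exact ((h.integrable_grad (hCU hθ₀)).norm.add
      ((h.integrable_hess (hCU hθ₀)).norm.mul_const _)).add (h.integrable_bound.mul_const _)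
  · have := h.bound_nonneg y
    positivity
  · filter_upwards [h.ae_taylor] with y hy θ hθ η hη
    refine hC.norm_image_sub_le_of_norm_hasFDerivWithin_le (𝕜 := ℝ)
      (f := fun θ => f θ y) (f' := fun θ => grad f θ y)
      (fun ξ hξ => (h.hasFDerivAt (hCU hξ) y).hasFDerivWithinAt) (fun ξ hξ => ?_) hη hθ
    have h1 := (hy C hCU hC ξ hξ θ₀ hθ₀).2
    have h2 : ‖hess f θ₀ y (ξ - θ₀)‖ ≤ ‖hess f θ₀ y‖ * D :=
      ((hess f θ₀ y).le_opNorm _).trans (by gcongr; exact hD ξ hξ)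
    have h3 : G y * ‖ξ - θ₀‖ ^ 2 ≤ G y * D ^ 2 :=
      mul_le_mul_of_nonneg_left (by gcongr; exact hD ξ hξ) (h.bound_nonneg y)
    have e : grad f ξ y = grad f θ₀ y + hess f θ₀ y (ξ - θ₀)
        + (grad f ξ y - grad f θ₀ y - hess f θ₀ y (ξ - θ₀)) := by abel
    rw [e]
    exact (norm_add₃_le).trans (by linarith)

/-- The lower bound required by the covering argument: near `θ₀` the score is at least its
(extended) value at `θ₀` minus a small multiple of an integrable Lipschitz constant. -/
theorem exists_local_lower_bound {V 𝒳 : Type*} [NormedAddCommGroup V] [MeasurableSpace 𝒳]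
    {f : V → 𝒳 → ℝ} {μ : Measure 𝒳} {A : Set V} {θ₀ : V} {b K : 𝒳 → ℝ} {c r : ℝ} (hr : 0 < r)
    (hb : Integrable b μ) (hcb : c < ∫ y, b y ∂μ) (hK : Integrable K μ) (hK0 : ∀ y, 0 ≤ K y)
    (hle : ∀ᵐ y ∂μ, ∀ θ ∈ Metric.ball θ₀ r ∩ A, b y - K y * ‖θ - θ₀‖ ≤ f θ y) :
    ∃ N ∈ 𝓝 θ₀, ∃ m : 𝒳 → ℝ, Integrable m μ ∧ c < ∫ y, m y ∂μ ∧
      ∀ᵐ y ∂μ, ∀ θ ∈ N ∩ A, m y ≤ f θ y := by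
  have hI : 0 ≤ ∫ y, K y ∂μ := integral_nonneg hK0
  set δ := min r (((∫ y, b y ∂μ) - c) / (2 * ((∫ y, K y ∂μ) + 1))) with hδ
  have hδ0 : 0 < δ := lt_min hr (div_pos (by linarith) (by linarith))
  refine ⟨Metric.ball θ₀ δ, Metric.ball_mem_nhds _ hδ0, fun y => b y - K y * δ,
    hb.sub (hK.mul_const _), ?_, ?_⟩
  · rw [integral_sub hb (hK.mul_const _), integral_mul_const]
    have h1 : δ ≤ ((∫ y, b y ∂μ) - c) / (2 * ((∫ y, K y ∂μ) + 1)) := min_le_right _ _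
    rw [le_div_iff₀ (by linarith)] at h1
    nlinarith
  · filter_upwards [hle] with y hy θ hθ
    have hθ1 : ‖θ - θ₀‖ < δ := by simpa [dist_eq_norm] using hθ.1
    have := hy θ ⟨Metric.ball_subset_ball (min_le_left _ _) hθ.1, hθ.2⟩
    have := mul_le_mul_of_nonneg_left hθ1.le (hK0 y)
    linarith

theorem separatesFrom_of_forall_nat {V : Type*} [NormedAddCommGroup V] {L : ℕ → V → ℝ} {Θ : Set V}
    {θs : V} {c : ℝ} (h : ∀ k : ℕ, ∃ η > 0, ∀ᶠ n in atTop, ∀ θ ∈ Θ,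
      1 / ((k : ℝ) + 1) ≤ ‖θ - θs‖ → c + η ≤ L n θ) : SeparatesFrom L Θ θs c := by
  intro ε hε
  obtain ⟨k, hk⟩ := exists_nat_one_div_lt hε
  obtain ⟨η, hη, hn⟩ := h k
  refine ⟨η, hη, ?_⟩
  filter_upwards [hn] with n hn θ hθ hθε using hn θ hθ (hk.le.trans hθε)

theorem sampleMean_eq_sum_sample {𝒳 Ω : Type*} {Y : ℕ → Ω → 𝒳} (f : 𝒳 → ℝ) (n : ℕ) (ω : Ω) :
    sampleMean f (fun i => Y i ω) n = 1 / (n : ℝ) * ∑ i, f (sample Y n ω i) := by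
  simp only [sampleMean, sample, smul_eq_mul, one_div, Fin.sum_univ_eq_sum_range
    (fun i => f (Y i ω))]

section Separation

variable {p : ℕ} {𝒳 Ω : Type*} [MeasurableSpace 𝒳] [MeasurableSpace Ω] {Y : ℕ → Ω → 𝒳}
  {ν : Measure Ω} {Θ : Set (EuclideanSpace ℝ (Fin p))} {S : ProbabilityMeasure 𝒳 → 𝒳 → ℝ}
  {P : EuclideanSpace ℝ (Fin p) → ProbabilityMeasure 𝒳} {P₀ : ProbabilityMeasure 𝒳}
  {θs : EuclideanSpace ℝ (Fin p)}

/-- On the compact set `K` separation holds by the covering argument, outside `K` by assumption. -/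
theorem ae_separatesFrom_of_separated (hY : IsIIDSample Y ν (P₀ : Measure 𝒳))
    (hmin : UniqueMinimizer Θ S P P₀ θs) {E : Set (EuclideanSpace ℝ (Fin p))} (hEΘ : E ⊆ Θ)
    {G : 𝒳 → ℝ} (hreg : RegularScore (fun θ y => S (P θ) y) (P₀ : Measure 𝒳) E G)
    (hsep : Separated ν Y Θ S P P₀ θs E) :
    ∀ᵐ ω ∂ν, SeparatesFrom (fun n θ => sampleMean (S (P θ)) (fun i => Y i ω) n) Θ θs
      (expectedScore S (P θs) P₀) := by
  obtain ⟨K, hK, hKE, -, hlim⟩ := hsep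
  have hcov : ∀ k : ℕ, ∃ η > 0, ∀ᵐ ω ∂ν, ∀ᶠ n in atTop,
      ∀ θ ∈ (K \ Metric.ball θs (1 / ((k : ℝ) + 1))) ∩ Set.univ,
      expectedScore S (P θs) P₀ + η ≤ sampleMean (S (P θ)) (fun i => Y i ω) n := by
    intro k
    refine hY.exists_lt_sampleMean_of_isCompact (f := fun θ => S (P θ))
      (hK.diff Metric.isOpen_ball) fun θ₀ hθ₀ => ?_
    have hθE : θ₀ ∈ E := hKE hθ₀.1
    have hne : θ₀ ≠ θs := by
      rintro rfl
      exact hθ₀.2 (Metric.mem_ball_self (by positivity))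
    obtain ⟨r, hr, hrE⟩ := Metric.isOpen_iff.1 hreg.isOpen θ₀ hθE
    obtain ⟨M, hM, hM0, hle⟩ := hreg.exists_integrable_lipschitz hrE (convex_ball θ₀ r)
      (Metric.mem_ball_self hr) (D := r) (fun θ hθ => by
        rw [mem_ball_iff_norm] at hθ; exact hθ.le)
    refine exists_local_lower_bound hr (hreg.integrable θ₀ hθE)
      (hmin.lt θ₀ (hEΘ hθE) hne) hM hM0 ?_
    filter_upwards [hle] with y hy θ hθ
    have := (abs_le.1 (hy θ hθ.1 θ₀ (Metric.mem_ball_self hr))).1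
    linarith
  choose η hη hae using hcov
  filter_upwards [hlim, ae_all_iff.2 hae] with ω hω hn
  obtain ⟨b, hcb, hb⟩ := EReal.exists_between_coe_real hω
  have hcb' : expectedScore S (P θs) P₀ < b := EReal.coe_lt_coe_iff.1 hcb
  refine separatesFrom_of_forall_nat fun k =>
    ⟨min (η k) (b - expectedScore S (P θs) P₀), lt_min (hη k) (by linarith), ?_⟩
  filter_upwards [eventually_lt_of_lt_liminf hb, hn k] with n h1 h2 θ hθ hθε
  by_cases hθK : θ ∈ K
  · have := h2 θ ⟨⟨hθK, by rw [mem_ball_iff_norm]; exact not_lt.2 hθε⟩, trivial⟩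
    linarith [min_le_left (η k) (b - expectedScore S (P θs) P₀)]
  · have h3 := h1.le.trans (iInf₂_le (f := fun θ (_ : θ ∈ Θ \ K) =>
      (((1 / (n : ℝ)) * ∑ i : Fin n, S (P θ) (sample Y n ω i) : ℝ) : EReal)) θ ⟨hθ, hθK⟩)
    have h4 := EReal.coe_le_coe_iff.1 h3
    rw [← sampleMean_eq_sum_sample] at h4
    linarith [min_le_right (η k) (b - expectedScore S (P θs) P₀)]

/-- The covering argument on the compact closure of `Θ`. The Lipschitz bound of the score on `Θ`
extends to the continuous extension, which yields integrability at boundary points. -/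
theorem ae_separatesFrom_of_regularBoundedSpace (hY : IsIIDSample Y ν (P₀ : Measure 𝒳))
    (hmin : UniqueMinimizer Θ S P P₀ θs) {G : 𝒳 → ℝ}
    (hreg : RegularScore (fun θ y => S (P θ) y) (P₀ : Measure 𝒳) Θ G)
    (hbdd : RegularBoundedSpace Θ S P P₀ θs) :
    ∀ᵐ ω ∂ν, SeparatesFrom (fun n θ => sampleMean (S (P θ)) (fun i => Y i ω) n) Θ θs
      (expectedScore S (P θs) P₀) := by
  obtain ⟨Sbar, hSbar, hcont, hlt⟩ := hbdd.extension
  obtain ⟨D, hD⟩ := Metric.isBounded_iff.1 hbdd.isBounded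
  obtain ⟨M, hM, hM0, hle⟩ := hreg.exists_integrable_lipschitz subset_rfl hbdd.convex hmin.mem
    (D := D) (fun θ hθ => by rw [← dist_eq_norm]; exact hD hθ hmin.mem)
  -- by continuity the Lipschitz bound extends to the boundary points
  have hle' : ∀ᵐ y ∂(P₀ : Measure 𝒳), ∀ θ₀ ∈ closure Θ, ∀ θ ∈ Θ,
      |S (P θ) y - Sbar θ₀ y| ≤ M y * ‖θ - θ₀‖ := by
    filter_upwards [hle] with y hy θ₀ hθ₀ θ hθ
    have hne : (𝓝[Θ] θ₀).NeBot := mem_closure_iff_nhdsWithin_neBot.1 hθ₀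
    have ht : Tendsto (fun η => Sbar η y) (𝓝[Θ] θ₀) (𝓝 (Sbar θ₀ y)) :=
      (hcont y θ₀ hθ₀).mono_left (nhdsWithin_mono _ subset_closure)
    have hid : Tendsto (fun η => η) (𝓝[Θ] θ₀) (𝓝 θ₀) := tendsto_id.mono_left nhdsWithin_le_nhds
    refine le_of_tendsto_of_tendsto (ht.const_sub (S (P θ) y)).abs
      ((hid.const_sub θ).norm.const_mul (M y)) ?_
    filter_upwards [self_mem_nhdsWithin] with η hη
    rw [hSbar η hη]
    exact hy θ hθ η hη
  have hcov : ∀ k : ℕ, ∃ η > 0, ∀ᵐ ω ∂ν, ∀ᶠ n in atTop,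
      ∀ θ ∈ (closure Θ \ Metric.ball θs (1 / ((k : ℝ) + 1))) ∩ Θ,
      expectedScore S (P θs) P₀ + η ≤ sampleMean (S (P θ)) (fun i => Y i ω) n := by
    intro k
    refine hY.exists_lt_sampleMean_of_isCompact (f := fun θ => S (P θ))
      ((hbdd.isBounded.isCompact_closure).diff Metric.isOpen_ball) fun θ₀ hθ₀ => ?_
    have hne : θ₀ ≠ θs := by
      rintro rfl
      exact hθ₀.2 (Metric.mem_ball_self (by positivity))
    have hmeas : Measurable (Sbar θ₀) := by
      obtain ⟨u, huΘ, hu⟩ := mem_closure_iff_seq_limit.1 hθ₀.1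
      refine measurable_of_tendsto_metrizable (f := fun n => S (P (u n)))
        (fun n => hreg.measurable _ (huΘ n)) ?_
      rw [tendsto_pi_nhds]
      intro y
      have := (hcont y θ₀ hθ₀.1).tendsto.comp (tendsto_nhdsWithin_iff.2
        ⟨hu, Eventually.of_forall fun n => subset_closure (huΘ n)⟩)
      exact this.congr fun n => hSbar _ (huΘ n) y
    have hint : Integrable (Sbar θ₀) (P₀ : Measure 𝒳) := by
      refine Integrable.mono' (g := fun y => |S (P θs) y| + M y * ‖θs - θ₀‖)
        ((hmin.integrable _ hmin.mem).abs.add (hM.mul_const _)) hmeas.aestronglyMeasurable ?_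
      filter_upwards [hle'] with y hy
      have h1 := abs_le.1 (hy θ₀ hθ₀.1 θs hmin.mem)
      have h2 := abs_le.1 (le_refl |S (P θs) y|)
      rw [Real.norm_eq_abs, abs_le]
      constructor <;> linarith [h1.1, h1.2, h2.1, h2.2]
    refine exists_local_lower_bound one_pos hint (hlt θ₀ hθ₀.1 hne) hM hM0 ?_
    filter_upwards [hle'] with y hy θ hθ
    have := (abs_le.1 (hy θ₀ hθ₀.1 θ hθ.2)).1
    linarith
  choose η hη hae using hcov
  filter_upwards [ae_all_iff.2 hae] with ω hn
  refine separatesFrom_of_forall_nat fun k => ⟨η k, hη k, ?_⟩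
  filter_upwards [hn k] with n h2 θ hθ hθε
  exact h2 θ ⟨⟨subset_closure hθ, by rw [mem_ball_iff_norm]; exact not_lt.2 hθε⟩, hθ⟩

end Separation

/-- For convex functions, the growth on a small sphere around `θs` given by the quadratic expansion
propagates to all of `Θ`. -/
theorem LocalExpansion.separatesFrom_of_convexOn {V : Type*} [NormedAddCommGroup V]
    [NormedSpace ℝ V] {L : ℕ → V → ℝ} {g : ℕ → V → V →L[ℝ] ℝ} {H : ℕ → V → V →L[ℝ] V →L[ℝ] ℝ}
    {κ : ℕ → ℝ} {θs : V} {r c : ℝ} {H₀ : V →L[ℝ] V →L[ℝ] ℝ} {κ₀ : ℝ}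
    (h : LocalExpansion L g H κ θs r c H₀ κ₀) {lam : ℝ} (hlam : 0 < lam)
    (hH : ∀ v, lam * ‖v‖ ^ 2 ≤ H₀ v v) {Θ : Set V} (hθs : θs ∈ Θ)
    (hconv : ∀ n, ConvexOn ℝ Θ (L n)) : SeparatesFrom L Θ θs c := by
  intro ε₁ hε₁
  obtain ⟨ε₀, hε₀, hgrow⟩ := h.exists_quadratic_growth hlam hH tendsto_const_nhds
  set ε := min ε₀ ε₁ with hε
  have hε0 : 0 < ε := lt_min hε₀ hε₁
  refine ⟨lam / 16 * ε ^ 2, by positivity, ?_⟩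
  filter_upwards [hgrow, h.tendsto_grad.norm.eventually_lt_const
    (show ‖(0 : V →L[ℝ] ℝ)‖ < lam / 8 * ε by rw [norm_zero]; positivity),
    h.tendsto_value.eventually_const_lt
      (show c - lam / 16 * ε ^ 2 < c by have : 0 < lam / 16 * ε ^ 2 := (by positivity); linarith)]
    with n h1 h2 h3 θ hθ hθε
  set d := ‖θ - θs‖ with hd
  have hdpos : 0 < d := hε₁.trans_le hθε
  have hεd : ε ≤ d := (min_le_right _ _).trans hθε
  set t := ε / d with ht
  have ht0 : 0 < t := by positivity
  have ht1 : t ≤ 1 := by rw [ht, div_le_one hdpos]; exact hεd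
  have hv : ‖t • (θ - θs)‖ = ε := by
    rw [norm_smul, Real.norm_of_nonneg ht0.le, ← hd, ht, div_mul_cancel₀ _ hdpos.ne']
  have hg := (h1 (t • (θ - θs)) (hv.trans_le (min_le_left _ _))).2
  rw [hv] at hg
  have hc := (hconv n).2 hθs hθ (sub_nonneg.2 ht1) ht0.le (by ring)
  rw [show (1 - t) • θs + t • θ = θs + t • (θ - θs) by rw [smul_sub, sub_smul, one_smul]; abel,
    smul_eq_mul, smul_eq_mul] at hc
  have h4 : lam / 8 * ε ^ 2 ≤ t * (L n θ - L n θs) := by nlinarith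
  have h5 : 0 ≤ L n θ - L n θs := by
    by_contra hneg
    have : t * (L n θ - L n θs) < 0 := mul_neg_of_pos_of_neg ht0 (not_le.1 hneg)
    have : 0 < lam / 8 * ε ^ 2 := by positivity
    linarith
  have h6 : t * (L n θ - L n θs) ≤ L n θ - L n θs := mul_le_of_le_one_left h5 ht1
  linarith

theorem convexOn_sampleMean {V 𝒳 : Type*} [AddCommGroup V] [Module ℝ V] {f : V → 𝒳 → ℝ}
    {Θ : Set V} (hf : ∀ y, ConvexOn ℝ Θ fun θ => f θ y) (hΘ : Convex ℝ Θ) (y : ℕ → 𝒳) (n : ℕ) :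
    ConvexOn ℝ Θ fun θ => sampleMean (f θ) y n := by
  refine ⟨hΘ, fun θ hθ η hη a b ha hb hab => ?_⟩
  simp only [smul_eq_mul]
  rw [← sampleMean_const_mul, ← sampleMean_const_mul, ← sampleMean_add]
  exact sampleMean_mono (fun i => (hf (y i)).2 hθ hη ha hb hab) n

/-! ### Expansion at an approximate minimizer -/

namespace LocalExpansion

variable {V : Type*} [NormedAddCommGroup V] [InnerProductSpace ℝ V]
    {L : ℕ → V → ℝ}
    {g : ℕ → V → V →L[ℝ] ℝ} {H : ℕ → V → V →L[ℝ] V →L[ℝ] ℝ} {κ : ℕ → ℝ} {θs : V} {r c : ℝ}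
    {H₀ : V →L[ℝ] V →L[ℝ] ℝ} {κ₀ : ℝ}

/-- A step of fixed relative length against the gradient decreases `L n` by a multiple of the
squared gradient. A minimizer of `L n` up to an error `o(1 / n)` therefore has a gradient
`o(1 / √n)`, which is negligible after rescaling. -/
theorem tendsto_mul_sq_norm_grad [CompleteSpace V]
    (h : LocalExpansion L g H κ θs r c H₀ κ₀) {u : ℕ → V}
    (hu : Tendsto u atTop (𝓝 θs)) {ρ : ℝ} (hρ : 0 < ρ) {δ : ℕ → ℝ}
    (hδ : Tendsto δ atTop (𝓝 0))
    (hmin : ∀ n : ℕ, ∀ θ ∈ Metric.closedBall θs ρ, n * (L n (u n) - L n θ) ≤ δ n) :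
    Tendsto (fun n : ℕ => n * ‖g n (u n)‖ ^ 2) atTop (𝓝 0) := by
  have hκ₀ : 0 ≤ κ₀ := ge_of_tendsto' h.tendsto_bound h.bound_nonneg
  have hr := h.radius_pos
  have hgrad := (h.tendsto_grad_of_tendsto hu).norm
  rw [norm_zero] at hgrad
  set T := ‖H₀‖ + 1 with hT
  have hT1 : 1 ≤ T := by rw [hT]; linarith [norm_nonneg H₀]
  refine squeeze_zero' (Eventually.of_forall fun n => by positivity) ?_
    (by simpa using hδ.const_mul (4 * T))
  have hm := lt_min (half_pos hr) (half_pos hρ)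
  filter_upwards [hu.eventually (Metric.ball_mem_nhds θs hm),
    (h.tendsto_hess_of_tendsto hu).norm.eventually_lt_const (lt_add_one ‖H₀‖),
    h.tendsto_bound.eventually_lt_const (lt_add_one κ₀),
    hgrad.eventually_lt_const hm,
    hgrad.eventually_lt_const (show 0 < 1 / (4 * (κ₀ + 1)) by positivity)] with n h1 h2 h3 h4 h5
  have h1' : ‖u n - θs‖ < min (r / 2) (ρ / 2) := by rwa [← dist_eq_norm]
  rw [lt_min_iff] at h1' h4
  set w := (InnerProductSpace.toDual ℝ V).symm (g n (u n)) with hw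
  have hwn : ‖w‖ = ‖g n (u n)‖ := LinearIsometryEquiv.norm_map _ _
  have hgw : g n (u n) w = ‖g n (u n)‖ ^ 2 := by
    rw [← hwn, ← real_inner_self_eq_norm_sq, hw, InnerProductSpace.toDual_symm_apply]
  set t := T⁻¹ with ht
  have ht0 : 0 < t := by positivity
  have ht1 : t ≤ 1 := inv_le_one_of_one_le₀ hT1
  set N := ‖g n (u n)‖ with hN
  have hN0 : 0 ≤ N := norm_nonneg _
  have hv : ‖-(t • w)‖ = t * N := by rw [norm_neg, norm_smul, Real.norm_of_nonneg ht0.le, hwn]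
  have htN : t * N ≤ N := mul_le_of_le_one_left hN0 ht1
  have hdist : ‖u n + -(t • w) - θs‖ ≤ ‖u n - θs‖ + N := by
    rw [add_sub_right_comm]
    exact (norm_add_le _ _).trans (by linarith)
  have m0 : u n ∈ Metric.ball θs r := by rw [mem_ball_iff_norm]; linarith
  have m1 : u n + -(t • w) ∈ Metric.ball θs r := by rw [mem_ball_iff_norm]; linarith
  have m2 : u n + -(t • w) ∈ Metric.closedBall θs ρ := by
    rw [mem_closedBall_iff_norm]; linarith
  have hm := hmin n _ m2
  have htay := (abs_le.1 (h.taylor_two n _ m1 _ m0)).2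
  rw [add_sub_cancel_left, hv] at htay
  have e1 : g n (u n) (-(t • w)) = -(t * N ^ 2) := by
    rw [map_neg, map_smul, hgw, smul_eq_mul]
  have e2 : H n (u n) (-(t • w)) (-(t • w)) ≤ T * (t * N) * (t * N) := by
    refine (le_abs_self _).trans (((H n (u n)).le_opNorm₂ _ _).trans ?_)
    rw [hv]; gcongr
  have e3 : κ n * (t * N) ^ 3 ≤ 1 / 4 * (t * N ^ 2) := by
    have a1 : (κ₀ + 1) * N ≤ 1 / 4 := by
      rw [lt_div_iff₀ (by positivity)] at h5; linarith
    calc κ n * (t * N) ^ 3 ≤ (κ₀ + 1) * (t * N) ^ 3 := by gcongr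
      _ = ((κ₀ + 1) * N) * (t * t) * (t * N ^ 2) := by ring
      _ ≤ 1 / 4 * (1 * 1) * (t * N ^ 2) := by gcongr
      _ = _ := by ring
  have e4 : T * (t * N) * (t * N) = t * N ^ 2 := by
    rw [ht]; field_simp
  rw [e1] at htay
  have e5 : 1 / 4 * (t * N ^ 2) ≤ L n (u n) - L n (u n + -(t • w)) := by linarith
  have e6 : (n : ℝ) * (1 / 4 * (t * N ^ 2)) ≤ δ n :=
    (mul_le_mul_of_nonneg_left e5 (Nat.cast_nonneg n)).trans hm
  have e7 : (n : ℝ) * N ^ 2 = 4 * T * ((n : ℝ) * (1 / 4 * (t * N ^ 2))) := by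
    rw [ht]; field_simp
  rw [e7]
  gcongr

theorem tendsto_sqrt_mul_norm_grad [CompleteSpace V]
    (h : LocalExpansion L g H κ θs r c H₀ κ₀) {u : ℕ → V}
    (hu : Tendsto u atTop (𝓝 θs)) {ρ : ℝ} (hρ : 0 < ρ) {δ : ℕ → ℝ}
    (hδ : Tendsto δ atTop (𝓝 0))
    (hmin : ∀ n : ℕ, ∀ θ ∈ Metric.closedBall θs ρ, n * (L n (u n) - L n θ) ≤ δ n) :
    Tendsto (fun n : ℕ => √(n : ℝ) * ‖g n (u n)‖) atTop (𝓝 0) := by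
  have := (h.tendsto_mul_sq_norm_grad hu hρ hδ hmin).sqrt
  rw [Real.sqrt_zero] at this
  refine this.congr fun n => ?_
  rw [Real.sqrt_mul (Nat.cast_nonneg n), Real.sqrt_sq (norm_nonneg _)]

/-- In the rescaled coordinate `s = √n (θ - u n)` only the quadratic term survives. -/
theorem tendsto_rescaled (h : LocalExpansion L g H κ θs r c H₀ κ₀) {u : ℕ → V}
    (hu : Tendsto u atTop (𝓝 θs))
    (hg : Tendsto (fun n : ℕ => √(n : ℝ) * ‖g n (u n)‖) atTop (𝓝 0)) (s : V) :
    Tendsto (fun n : ℕ => n * (L n (u n + (√(n : ℝ))⁻¹ • s) - L n (u n))) atTop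
      (𝓝 (1 / 2 * H₀ s s)) := by
  have hsq : Tendsto (fun n : ℕ => √(n : ℝ)) atTop atTop :=
    Real.tendsto_sqrt_atTop.comp tendsto_natCast_atTop_atTop
  have hinv : Tendsto (fun n : ℕ => (√(n : ℝ))⁻¹) atTop (𝓝 0) := hsq.inv_tendsto_atTop
  have hus : Tendsto (fun n : ℕ => u n + (√(n : ℝ))⁻¹ • s) atTop (𝓝 θs) := by
    simpa using hu.add (hinv.smul_const s)
  have hHs : Tendsto (fun n => H n (u n) s s) atTop (𝓝 (H₀ s s)) := by
    have h1 := h.tendsto_hess_of_tendsto hu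
    exact (((ContinuousLinearMap.apply ℝ ℝ s).continuous.comp
      (ContinuousLinearMap.apply ℝ (V →L[ℝ] ℝ) s).continuous).tendsto H₀).comp h1
  have hrem : Tendsto (fun n : ℕ => √(n : ℝ) * ‖g n (u n)‖ * ‖s‖ + κ n * (√(n : ℝ))⁻¹ * ‖s‖ ^ 3)
      atTop (𝓝 0) := by
    simpa using (hg.mul_const ‖s‖).add ((h.tendsto_bound.mul hinv).mul_const (‖s‖ ^ 3))
  have hdiff : Tendsto (fun n : ℕ => n * (L n (u n + (√(n : ℝ))⁻¹ • s) - L n (u n))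
      - 1 / 2 * H n (u n) s s) atTop (𝓝 0) := by
    refine squeeze_zero_norm' ?_ hrem
    filter_upwards [hu.eventually (Metric.ball_mem_nhds θs h.radius_pos),
      hus.eventually (Metric.ball_mem_nhds θs h.radius_pos), eventually_gt_atTop 0] with n m0 m1 hn
    have hnpos : (0 : ℝ) < n := Nat.cast_pos.2 hn
    set q := √(n : ℝ) with hq
    have hq0 : 0 < q := Real.sqrt_pos.2 hnpos
    have hqq : (n : ℝ) = q * q := (Real.mul_self_sqrt hnpos.le).symm
    have ht := h.taylor_two n _ m1 _ m0
    rw [add_sub_cancel_left, norm_smul, norm_inv, Real.norm_of_nonneg hq0.le] at ht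
    simp only [map_smul, smul_apply, smul_eq_mul] at ht
    have hgs : |g n (u n) s| ≤ ‖g n (u n)‖ * ‖s‖ := (g n (u n)).le_opNorm s
    rw [Real.norm_eq_abs]
    have e : (n : ℝ) * (L n (u n + q⁻¹ • s) - L n (u n)) - 1 / 2 * H n (u n) s s
        = n * (L n (u n + q⁻¹ • s) - L n (u n) - q⁻¹ * g n (u n) s
            - 1 / 2 * (q⁻¹ * (q⁻¹ * H n (u n) s s))) + q * g n (u n) s := by
      rw [hqq]; field_simp; ring
    rw [e]
    refine (abs_add_le _ _).trans ?_
    rw [abs_mul, abs_mul, abs_of_pos hq0, abs_of_pos hnpos, add_comm]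
    refine add_le_add ?_ ?_
    · rw [mul_assoc]; gcongr
    · refine (mul_le_mul_of_nonneg_left ht hnpos.le).trans (le_of_eq ?_)
      rw [hqq]; field_simp
  have := hdiff.add (hHs.const_mul (1 / 2))
  rw [zero_add] at this
  exact this.congr fun n => by ring

end LocalExpansion

/-! ### The Laplace approximation -/

theorem integrable_exp_neg_mul_sq_norm {p : ℕ} {b : ℝ} (hb : 0 < b) :
    Integrable fun s : EuclideanSpace ℝ (Fin p) => Real.exp (-b * ‖s‖ ^ 2) := by
  by_contra hn
  have h1 := GaussianFourier.integral_rexp_neg_mul_sq_norm (V := EuclideanSpace ℝ (Fin p)) hb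
  rw [integral_undef hn] at h1
  have : 0 < (Real.pi / b) ^ ((Module.finrank ℝ (EuclideanSpace ℝ (Fin p)) : ℝ) / 2) := by
    positivity
  linarith

theorem integrable_exp_norm_sub_mul_sq_norm {p : ℕ} {b : ℝ} (hb : 0 < b) :
    Integrable fun s : EuclideanSpace ℝ (Fin p) => Real.exp (‖s‖ - b * ‖s‖ ^ 2) := by
  refine Integrable.mono' (g := fun s => Real.exp (1 / (2 * b)) * Real.exp (-(b / 2) * ‖s‖ ^ 2))
    ((integrable_exp_neg_mul_sq_norm (half_pos hb)).const_mul _)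
    (Continuous.aestronglyMeasurable (by fun_prop)) (Eventually.of_forall fun s => ?_)
  rw [Real.norm_of_nonneg (Real.exp_pos _).le, ← Real.exp_add, Real.exp_le_exp]
  have h1 : 1 / (2 * b) + -(b / 2) * ‖s‖ ^ 2 - (‖s‖ - b * ‖s‖ ^ 2)
      = (b * ‖s‖ - 1) ^ 2 / (2 * b) := by field_simp; ring
  have h2 : 0 ≤ (b * ‖s‖ - 1) ^ 2 / (2 * b) := by positivity
  linarith

theorem tendsto_exp_neg_mul_mul_sqrt_pow (p : ℕ) {η : ℝ} (hη : 0 < η) :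
    Tendsto (fun n : ℕ => Real.exp (-(n * η)) * √(n : ℝ) ^ p) atTop (𝓝 0) := by
  have h1 : Tendsto (fun n : ℕ => (n : ℝ) * η) atTop atTop :=
    tendsto_natCast_atTop_atTop.atTop_mul_const hη
  have h2 := ((Real.tendsto_pow_mul_exp_neg_atTop_nhds_zero p).comp h1).mul_const ((η ^ p)⁻¹)
  rw [zero_mul] at h2
  refine squeeze_zero' (Eventually.of_forall fun n => by positivity) ?_ h2
  filter_upwards [eventually_ge_atTop 1] with n hn
  have hn1 : (1 : ℝ) ≤ n := by exact_mod_cast hn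
  have hs : √(n : ℝ) ≤ n := by
    rw [Real.sqrt_le_left (by positivity)]; nlinarith
  calc Real.exp (-(n * η)) * √(n : ℝ) ^ p ≤ Real.exp (-(n * η)) * (n : ℝ) ^ p := by gcongr
    _ = _ := by simp only [Function.comp]; field_simp; rw [mul_pow]

theorem measurable_indicator_of_subtype {V : Type*} [MeasurableSpace V] {Θ : Set V}
    (hΘ : MeasurableSet Θ) {w : V → ℝ} (hw : Measurable fun θ : Θ => w θ) :
    Measurable (Θ.indicator w) := by
  have h1 : Θ.domRestrict (Θ.indicator w) = fun θ : Θ => w θ :=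
    funext fun x => Set.indicator_of_mem x.2 w
  have h2 : Θᶜ.domRestrict (Θ.indicator w) = fun _ => 0 :=
    funext fun x => Set.indicator_of_notMem x.2 w
  exact measurable_of_restrict_of_restrict_compl hΘ (h1 ▸ hw) (h2 ▸ measurable_const)

/-- The posterior weight in the coordinates `s = √n (θ - u)`, normalized by `Q = 0` at `u`. -/
noncomputable def localWeight {p : ℕ} (Θ : Set (EuclideanSpace ℝ (Fin p)))
    (π : EuclideanSpace ℝ (Fin p) → ℝ) (Q : EuclideanSpace ℝ (Fin p) → ℝ) (n : ℕ)
    (u s : EuclideanSpace ℝ (Fin p)) : ℝ :=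
  Θ.indicator (fun θ => π θ * Real.exp (-Q θ)) (u + (√(n : ℝ))⁻¹ • s)

theorem IsPriorDensity.integrable_indicator {p : ℕ} {Θ : Set (EuclideanSpace ℝ (Fin p))}
    (hΘ : MeasurableSet Θ) {π : EuclideanSpace ℝ (Fin p) → ℝ} (hπ : IsPriorDensity Θ π) :
    Integrable (Θ.indicator π) ∧ ∫ θ, Θ.indicator π θ = 1 := by
  have hm := measurable_indicator_of_subtype hΘ hπ.measurable
  have h0 : ∀ θ, 0 ≤ Θ.indicator π θ := Set.indicator_nonneg hπ.nonneg
  have hl : ∫⁻ θ, ENNReal.ofReal (Θ.indicator π θ) = 1 := by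
    rw [← hπ.lintegral_eq_one, ← lintegral_indicator hΘ]
    refine lintegral_congr fun θ => ?_
    by_cases hθ : θ ∈ Θ <;> simp [hθ]
  refine ⟨⟨hm.aestronglyMeasurable, ?_⟩, ?_⟩
  · rw [hasFiniteIntegral_iff_ofReal (Eventually.of_forall h0), hl]
    exact ENNReal.one_lt_top
  · rw [integral_eq_lintegral_of_nonneg_ae (Eventually.of_forall h0) hm.aestronglyMeasurable, hl]
    rfl

/-- Laplace's method: the rescaled posterior weight converges in `L¹` to a multiple of `exp (-B)`.
Within a fixed distance of the centre this is dominated convergence, with the quadratic growth of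
`Q n` providing the bound. Farther away `Q n ≥ n η`, so the mass is at most `exp (-n η) (√n) ^ p`, the
power of `√n` being the Jacobian of the change of variables. -/
theorem tendsto_integral_abs_localWeight_sub {p : ℕ} {Θ : Set (EuclideanSpace ℝ (Fin p))}
    (hΘ : MeasurableSet Θ) {π : EuclideanSpace ℝ (Fin p) → ℝ} (hπ : IsPriorDensity Θ π)
    {θs : EuclideanSpace ℝ (Fin p)} (hcont : ContinuousWithinAt π Θ θs)
    {u : ℕ → EuclideanSpace ℝ (Fin p)} (hu : Tendsto u atTop (𝓝 θs))
    {Q : ℕ → EuclideanSpace ℝ (Fin p) → ℝ} (hQm : ∀ n, Measurable fun θ : Θ => Q n θ)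
    {B : EuclideanSpace ℝ (Fin p) → ℝ} (hB : Continuous B)
    (hlim : ∀ s, Tendsto (fun n : ℕ => Q n (u n + (√(n : ℝ))⁻¹ • s)) atTop (𝓝 (B s)))
    {ε₀ b : ℝ} (hε₀ : 0 < ε₀) (hb : 0 < b)
    (hgrow : ∀ᶠ n : ℕ in atTop, ∀ v, ‖v‖ ≤ ε₀ → u n + v ∈ Θ ∧
      b * (n * ‖v‖ ^ 2) - √(n : ℝ) * ‖v‖ ≤ Q n (u n + v))
    (hsep : ∀ ε > 0, ∃ η > 0, ∀ᶠ n : ℕ in atTop, ∀ θ ∈ Θ, ε ≤ ‖θ - u n‖ → n * η ≤ Q n θ) :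
    Integrable (fun s => Real.exp (-B s)) ∧
    (∀ᶠ n : ℕ in atTop, Integrable (localWeight Θ π (Q n) n (u n))) ∧
    Tendsto (fun n : ℕ => ∫ s, |localWeight Θ π (Q n) n (u n) s - π θs * Real.exp (-B s)|) atTop
      (𝓝 0) := by
  -- a radius on which the quadratic growth holds and the prior density is bounded
  obtain ⟨ρ, hρ, hπb⟩ : ∃ ρ > 0, ∀ θ ∈ Θ, ‖θ - θs‖ < ρ → π θ ≤ π θs + 1 := by
    have := hcont.eventually_lt_const (lt_add_one (π θs))
    obtain ⟨ρ, hρ, h⟩ := Metric.mem_nhdsWithin_iff.1 this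
    exact ⟨ρ, hρ, fun θ hθ hd => (h ⟨mem_ball_iff_norm.2 hd, hθ⟩ : π θ < π θs + 1).le⟩
  set ε := min ε₀ (ρ / 2) with hε
  have hε0 : 0 < ε := lt_min hε₀ (half_pos hρ)
  obtain ⟨η, hη, hout⟩ := hsep ε hε0
  set E : EuclideanSpace ℝ (Fin p) → ℝ := fun s => Real.exp (‖s‖ - b * ‖s‖ ^ 2) with hE
  have hEint : Integrable E := integrable_exp_norm_sub_mul_sq_norm hb
  have hsq : Tendsto (fun n : ℕ => √(n : ℝ)) atTop atTop :=
    Real.tendsto_sqrt_atTop.comp tendsto_natCast_atTop_atTop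
  have hinv : Tendsto (fun n : ℕ => (√(n : ℝ))⁻¹) atTop (𝓝 0) := hsq.inv_tendsto_atTop
  have hvs : ∀ s : EuclideanSpace ℝ (Fin p),
      Tendsto (fun n : ℕ => (√(n : ℝ))⁻¹ • s) atTop (𝓝 0) := fun s => by
    simpa using hinv.smul_const s
  have hsmall : ∀ s : EuclideanSpace ℝ (Fin p), ∀ᶠ n : ℕ in atTop, ‖(√(n : ℝ))⁻¹ • s‖ ≤ ε := by
    intro s
    have := (hvs s).norm
    rw [norm_zero] at this
    exact (this.eventually_lt_const hε0).mono fun n hn => hn.le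
  have hθs : 0 ≤ π θs + 1 := by
    obtain ⟨n, hn, hnu⟩ := (hgrow.and (hu.eventually (Metric.ball_mem_nhds θs hρ))).exists
    have hm : u n ∈ Θ := by simpa using (hn 0 (by simpa using hε₀.le)).1
    exact (hπ.nonneg _ hm).trans (hπb _ hm (mem_ball_iff_norm.1 hnu))
  have hgrow' : ∀ᶠ n : ℕ in atTop, ∀ s : EuclideanSpace ℝ (Fin p), ‖(√(n : ℝ))⁻¹ • s‖ ≤ ε →
      u n + (√(n : ℝ))⁻¹ • s ∈ Θ ∧ b * ‖s‖ ^ 2 - ‖s‖ ≤ Q n (u n + (√(n : ℝ))⁻¹ • s) := by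
    filter_upwards [hgrow, eventually_gt_atTop 0] with n h1 hn s hs
    have hnpos : (0 : ℝ) < n := Nat.cast_pos.2 hn
    obtain ⟨m, hm⟩ := h1 _ (hs.trans (min_le_left _ _))
    refine ⟨m, ?_⟩
    have hq0 : 0 < √(n : ℝ) := Real.sqrt_pos.2 hnpos
    have e1 : √(n : ℝ) * ‖(√(n : ℝ))⁻¹ • s‖ = ‖s‖ := by
      rw [norm_smul, norm_inv, Real.norm_of_nonneg hq0.le, mul_inv_cancel_left₀ hq0.ne']
    have e2 : (n : ℝ) * ‖(√(n : ℝ))⁻¹ • s‖ ^ 2 = ‖s‖ ^ 2 := by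
      rw [← e1, mul_pow, Real.sq_sqrt hnpos.le]
    rwa [e1, e2] at hm
  have hBE : ∀ s, Real.exp (-B s) ≤ E s := by
    intro s
    rw [hE, Real.exp_le_exp]
    have : b * ‖s‖ ^ 2 - ‖s‖ ≤ B s := by
      refine ge_of_tendsto (hlim s) ?_
      filter_upwards [hgrow', hsmall s] with n h1 h2 using (h1 s h2).2
    linarith
  have hBint : Integrable fun s => Real.exp (-B s) :=
    hEint.mono' (Continuous.aestronglyMeasurable (by fun_prop))
      (Eventually.of_forall fun s => by
        rw [Real.norm_of_nonneg (Real.exp_pos _).le]; exact hBE s)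
  have hWm : ∀ n, Measurable (localWeight Θ π (Q n) n (u n)) := fun n =>
    (measurable_indicator_of_subtype hΘ (hπ.measurable.mul (hQm n).neg.exp)).comp (by fun_prop)
  have hW0 : ∀ n s, 0 ≤ localWeight Θ π (Q n) n (u n) s := fun n s =>
    Set.indicator_nonneg (fun θ hθ => mul_nonneg (hπ.nonneg θ hθ) (Real.exp_pos _).le) _
  -- the weight is split at distance `ε` from the centre
  set A : ℕ → Set (EuclideanSpace ℝ (Fin p)) := fun n => {s | ‖(√(n : ℝ))⁻¹ • s‖ ≤ ε} with hA
  have hAm : ∀ n, MeasurableSet (A n) := fun n =>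
    measurableSet_le (by fun_prop) measurable_const
  set inner : ℕ → EuclideanSpace ℝ (Fin p) → ℝ := fun n =>
    (A n).indicator (localWeight Θ π (Q n) n (u n)) with hinner
  set outer : ℕ → EuclideanSpace ℝ (Fin p) → ℝ := fun n =>
    (A n)ᶜ.indicator (localWeight Θ π (Q n) n (u n)) with houter
  have hsplit : ∀ n s, localWeight Θ π (Q n) n (u n) s = inner n s + outer n s := fun n s =>
    (congrFun (Set.indicator_self_add_compl (A n) (localWeight Θ π (Q n) n (u n))) s).symm
  have hinner_le : ∀ᶠ n in atTop, ∀ s, ‖inner n s‖ ≤ (π θs + 1) * E s := by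
    filter_upwards [hgrow', hu.eventually (Metric.ball_mem_nhds θs (half_pos hρ))] with n h1 h2 s
    rw [Real.norm_of_nonneg (Set.indicator_nonneg (fun s _ => hW0 n s) s)]
    by_cases hs : s ∈ A n
    · obtain ⟨m, hm⟩ := h1 s hs
      have hs' : ‖(√(n : ℝ))⁻¹ • s‖ ≤ ρ / 2 := (show ‖_‖ ≤ ε from hs).trans (min_le_right _ _)
      have hnear : ‖u n + (√(n : ℝ))⁻¹ • s - θs‖ < ρ := by
        rw [add_sub_right_comm]
        have := mem_ball_iff_norm.1 h2
        exact (norm_add_le _ _).trans_lt (by linarith)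
      rw [Set.indicator_of_mem hs, localWeight, Set.indicator_of_mem m]
      refine mul_le_mul (hπb _ m hnear) ?_ (Real.exp_pos _).le hθs
      rw [hE, Real.exp_le_exp]
      linarith
    · rw [Set.indicator_of_notMem hs]
      exact mul_nonneg hθs (Real.exp_pos _).le
  have hinner_int : ∀ᶠ n in atTop, Integrable (inner n) := by
    filter_upwards [hinner_le] with n hn
    exact (hEint.const_mul _).mono' ((hWm n).indicator (hAm n)).aestronglyMeasurable
      (Eventually.of_forall hn)
  obtain ⟨hπi, hπ1⟩ := hπ.integrable_indicator hΘ
  have hπs : ∀ n : ℕ, 0 < n → Integrable (fun s => Θ.indicator π (u n + (√(n : ℝ))⁻¹ • s)) ∧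
      ∫ s, Θ.indicator π (u n + (√(n : ℝ))⁻¹ • s) = √(n : ℝ) ^ p := by
    intro n hn
    have hq0 : 0 < √(n : ℝ) := Real.sqrt_pos.2 (Nat.cast_pos.2 hn)
    refine ⟨(hπi.comp_add_left (u n)).comp_smul (inv_ne_zero hq0.ne'), ?_⟩
    rw [Measure.integral_comp_smul volume (fun x => Θ.indicator π (u n + x)),
      integral_add_left_eq_self, hπ1]
    simp [abs_of_pos hq0]
  have houter_le : ∀ᶠ n : ℕ in atTop, ∀ s, ‖outer n s‖ ≤
      Real.exp (-(n * η)) * Θ.indicator π (u n + (√(n : ℝ))⁻¹ • s) := by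
    filter_upwards [hout] with n hn s
    have hnn : 0 ≤ Real.exp (-(n * η)) * Θ.indicator π (u n + (√(n : ℝ))⁻¹ • s) :=
      mul_nonneg (Real.exp_pos _).le (Set.indicator_nonneg hπ.nonneg _)
    rw [Real.norm_of_nonneg (Set.indicator_nonneg (fun s _ => hW0 n s) s)]
    by_cases hs : s ∈ A n
    · rw [Set.indicator_of_notMem (by simpa using hs)]
      exact hnn
    · rw [Set.indicator_of_mem (show s ∈ (A n)ᶜ from hs), localWeight]
      by_cases hm : u n + (√(n : ℝ))⁻¹ • s ∈ Θ
      · rw [Set.indicator_of_mem hm, Set.indicator_of_mem hm, mul_comm]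
        refine mul_le_mul_of_nonneg_right ?_ (hπ.nonneg _ hm)
        rw [Real.exp_le_exp, neg_le_neg_iff]
        refine hn _ hm ?_
        rw [add_sub_cancel_left]
        exact (not_le.1 hs).le
      · rw [Set.indicator_of_notMem hm, Set.indicator_of_notMem hm, mul_zero]
  have houter_int : ∀ᶠ n in atTop, Integrable (outer n) := by
    filter_upwards [houter_le, eventually_gt_atTop 0] with n hn hpos
    exact ((hπs n hpos).1.const_mul _).mono' ((hWm n).indicator (hAm n).compl).aestronglyMeasurable
      (Eventually.of_forall hn)
  have hinner_lim : Tendsto (fun n => ∫ s, |inner n s - π θs * Real.exp (-B s)|) atTop (𝓝 0) := by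
    have := tendsto_integral_filter_of_dominated_convergence (μ := volume) (l := atTop)
      (F := fun n s => |inner n s - π θs * Real.exp (-B s)|) (f := fun _ => (0 : ℝ))
      (fun s => (π θs + 1) * E s + |π θs| * E s) ?_ ?_
      ((hEint.const_mul _).add (hEint.const_mul _)) ?_
    · simpa using this
    · filter_upwards [hinner_int] with n hn
      exact (hn.sub (hBint.const_mul _)).abs.aestronglyMeasurable
    · filter_upwards [hinner_le] with n hn
      refine Eventually.of_forall fun s => ?_
      rw [Real.norm_eq_abs, abs_abs]
      refine (abs_sub _ _).trans (add_le_add (hn s) ?_)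
      rw [abs_mul, abs_of_pos (Real.exp_pos _)]
      exact mul_le_mul_of_nonneg_left (hBE s) (abs_nonneg _)
    · refine Eventually.of_forall fun s => ?_
      have hmem : ∀ᶠ n : ℕ in atTop, u n + (√(n : ℝ))⁻¹ • s ∈ Θ := by
        filter_upwards [hgrow', hsmall s] with n h1 h2 using (h1 s h2).1
      have ht : Tendsto (fun n : ℕ => u n + (√(n : ℝ))⁻¹ • s) atTop (𝓝[Θ] θs) :=
        tendsto_nhdsWithin_iff.2 ⟨by simpa using hu.add (hvs s), hmem⟩
      have h1 := (hcont.tendsto.comp ht).mul (hlim s).neg.rexp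
      have h2 := (h1.sub_const (π θs * Real.exp (-B s))).abs
      rw [sub_self, abs_zero] at h2
      refine h2.congr' ?_
      filter_upwards [hmem, hsmall s] with n hm hs
      rw [show inner n s = localWeight Θ π (Q n) n (u n) s from
        Set.indicator_of_mem (show s ∈ A n from hs) _, localWeight, Set.indicator_of_mem hm]
      rfl
  refine ⟨hBint, ?_, ?_⟩
  · filter_upwards [hinner_int, houter_int] with n h1 h2
    exact (h1.add h2).congr (Eventually.of_forall fun s => (hsplit n s).symm)
  · have hsum := hinner_lim.add (tendsto_exp_neg_mul_mul_sqrt_pow p hη)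
    rw [add_zero] at hsum
    refine squeeze_zero' (Eventually.of_forall fun n => integral_nonneg fun s => abs_nonneg _)
      ?_ hsum
    filter_upwards [hinner_int, houter_int, houter_le, eventually_gt_atTop 0] with n h1 h2 h3 hn
    obtain ⟨h4, h5⟩ := hπs n hn
    have h6 : Integrable fun s => |inner n s - π θs * Real.exp (-B s)| :=
      (h1.sub (hBint.const_mul (π θs))).abs
    rw [← h5, ← integral_const_mul, ← integral_add h6 (h4.const_mul _)]
    refine integral_mono_of_nonneg (Eventually.of_forall fun s => abs_nonneg _)
      (h6.add (h4.const_mul _)) (Eventually.of_forall fun s => ?_)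
    beta_reduce
    rw [hsplit n s, add_sub_right_comm]
    exact (abs_add_le _ _).trans (add_le_add le_rfl (h3 s))

/-- `L¹` convergence of integrable functions is preserved by dividing by the integrals. -/
theorem tendsto_integral_abs_normalized_sub {V : Type*} [MeasurableSpace V] {μ : Measure V}
    {W : ℕ → V → ℝ} {W₀ : V → ℝ} (hW : ∀ᶠ n in atTop, Integrable (W n) μ)
    (hW₀ : Integrable W₀ μ) (h0 : ∀ s, 0 ≤ W₀ s) (hpos : 0 < ∫ s, W₀ s ∂μ)
    (hlim : Tendsto (fun n => ∫ s, |W n s - W₀ s| ∂μ) atTop (𝓝 0)) :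
    (∀ᶠ n in atTop, 0 < ∫ s, W n s ∂μ) ∧
    Tendsto (fun n => ∫ s, |W n s / (∫ s, W n s ∂μ) - W₀ s / (∫ s, W₀ s ∂μ)| ∂μ) atTop
      (𝓝 0) := by
  set z := ∫ s, W₀ s ∂μ with hz
  have hzn : Tendsto (fun n => ∫ s, W n s ∂μ) atTop (𝓝 z) := by
    rw [tendsto_iff_norm_sub_tendsto_zero]
    refine squeeze_zero' (Eventually.of_forall fun n => norm_nonneg _) ?_ hlim
    filter_upwards [hW] with n hn
    rw [hz, ← integral_sub hn hW₀]
    exact norm_integral_le_integral_norm _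
  have hev := hzn.eventually_const_lt hpos
  refine ⟨hev, ?_⟩
  have hinv : Tendsto (fun n => (∫ s, W n s ∂μ)⁻¹) atTop (𝓝 z⁻¹) := hzn.inv₀ hpos.ne'
  have hbound : Tendsto (fun n => (∫ s, |W n s - W₀ s| ∂μ) * (∫ s, W n s ∂μ)⁻¹
      + z * |(∫ s, W n s ∂μ)⁻¹ - z⁻¹|) atTop (𝓝 0) := by
    have := (hlim.mul hinv).add (((hinv.sub_const z⁻¹).abs).const_mul z)
    simpa using this
  refine squeeze_zero' (Eventually.of_forall fun n => integral_nonneg fun s => abs_nonneg _)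
    ?_ hbound
  filter_upwards [hW, hev] with n hn hnpos
  have hd : Integrable (fun s => |W n s - W₀ s|) μ := (hn.sub hW₀).abs
  rw [← integral_mul_const, hz, ← integral_mul_const, ← integral_add (hd.mul_const _)
    (hW₀.mul_const _)]
  refine integral_mono_of_nonneg (Eventually.of_forall fun s => abs_nonneg _)
    ((hd.mul_const _).add (hW₀.mul_const _)) (Eventually.of_forall fun s => ?_)
  rw [← hz]
  have e : W n s / (∫ s, W n s ∂μ) - W₀ s / z = (W n s - W₀ s) * (∫ s, W n s ∂μ)⁻¹
      + W₀ s * ((∫ s, W n s ∂μ)⁻¹ - z⁻¹) := by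
    rw [div_eq_mul_inv, div_eq_mul_inv]; ring
  beta_reduce
  rw [e]
  refine (abs_add_le _ _).trans (le_of_eq ?_)
  rw [abs_mul, abs_mul, abs_of_pos (inv_pos.2 hnpos), abs_of_nonneg (h0 s)]

/-! ### The Gaussian limit -/

open scoped MatrixOrder Matrix.Norms.L2Operator in
/-- The square root of a positive definite matrix, as a linear isomorphism that turns the quadratic
form of the matrix into the squared norm. -/
theorem exists_norm_sq_eq_of_posDef {p : ℕ} {H : Matrix (Fin p) (Fin p) ℝ} (hH : H.PosDef) :
    ∃ T T' : EuclideanSpace ℝ (Fin p) →L[ℝ] EuclideanSpace ℝ (Fin p), (∀ v, T' (T v) = v) ∧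
      LinearMap.det (T : EuclideanSpace ℝ (Fin p) →ₗ[ℝ] EuclideanSpace ℝ (Fin p)) ^ 2 = H.det ∧
      ∀ v, ‖T v‖ ^ 2 = v.ofLp ⬝ᵥ H.mulVec v.ofLp := by
  set B := CFC.sqrt H with hB
  have hBB : B * B = H := CFC.sqrt_mul_sqrt_self H hH.posSemidef.nonneg
  have hdet : B.det ^ 2 = H.det := by rw [← hBB, Matrix.det_mul, sq]
  have hunit : IsUnit B.det := by
    refine isUnit_iff_ne_zero.2 fun h => ?_
    rw [h] at hdet
    have := hH.det_pos
    simp [← hdet] at this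
  have hsa : B.transpose = B := by
    rw [← Matrix.conjTranspose_eq_transpose_of_trivial]
    exact (Matrix.nonneg_iff_posSemidef.1 (CFC.sqrt_nonneg H)).isHermitian
  refine ⟨Matrix.toEuclideanCLM (𝕜 := ℝ) B, Matrix.toEuclideanCLM (𝕜 := ℝ) B⁻¹, fun v => ?_, ?_,
    fun v => ?_⟩
  · rw [← mul_apply_eq_comp, ← map_mul, Matrix.nonsing_inv_mul _ hunit, map_one,
      one_apply_eq_self]
  · rw [← hdet, Matrix.coe_toEuclideanCLM_eq_toEuclideanLin,
      Matrix.toEuclideanLin_eq_toLin_orthonormal, LinearMap.det_toLin]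
  · rw [← real_inner_self_eq_norm_sq, Matrix.inner_toEuclideanCLM, Matrix.ofLp_toEuclideanCLM]
    conv_rhs => rw [← hBB, ← Matrix.mulVec_mulVec, Matrix.dotProduct_mulVec,
      ← Matrix.mulVec_transpose, hsa]

theorem exists_coercive_of_posDef {p : ℕ} {H : Matrix (Fin p) (Fin p) ℝ} (hH : H.PosDef) :
    ∃ lam > 0, ∀ v : EuclideanSpace ℝ (Fin p), lam * ‖v‖ ^ 2 ≤ v.ofLp ⬝ᵥ H.mulVec v.ofLp := by
  obtain ⟨T, T', hT, -, hsq⟩ := exists_norm_sq_eq_of_posDef hH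
  refine ⟨(‖T'‖ ^ 2 + 1)⁻¹, by positivity, fun v => ?_⟩
  rw [← hsq, inv_mul_le_iff₀ (by positivity)]
  have h1 : ‖v‖ ≤ ‖T'‖ * ‖T v‖ := by
    conv_lhs => rw [← hT v]
    exact T'.le_opNorm _
  calc ‖v‖ ^ 2 ≤ (‖T'‖ * ‖T v‖) ^ 2 := by gcongr
    _ = ‖T'‖ ^ 2 * ‖T v‖ ^ 2 := by ring
    _ ≤ (‖T'‖ ^ 2 + 1) * ‖T v‖ ^ 2 := by gcongr; linarith

theorem integral_exp_neg_half_posDef {p : ℕ} {H : Matrix (Fin p) (Fin p) ℝ} (hH : H.PosDef) :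
    ∫ s : EuclideanSpace ℝ (Fin p), Real.exp (-(1 / 2) * (s.ofLp ⬝ᵥ H.mulVec s.ofLp))
      = Real.sqrt ((2 * Real.pi) ^ p * H⁻¹.det) := by
  obtain ⟨T, T', hT, hdet, hsq⟩ := exists_norm_sq_eq_of_posDef hH
  have hpos := hH.det_pos
  set d := LinearMap.det (T : EuclideanSpace ℝ (Fin p) →ₗ[ℝ] EuclideanSpace ℝ (Fin p)) with hd
  have hd0 : d ≠ 0 := by
    rintro h
    rw [h] at hdet
    simp [← hdet] at hpos
  have hmap := Measure.map_linearMap_addHaar_eq_smul_addHaar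
    (volume : Measure (EuclideanSpace ℝ (Fin p)))
    (f := (T : EuclideanSpace ℝ (Fin p) →ₗ[ℝ] EuclideanSpace ℝ (Fin p))) hd0
  have h1 : ∫ s : EuclideanSpace ℝ (Fin p), Real.exp (-(1 / 2) * (s.ofLp ⬝ᵥ H.mulVec s.ofLp))
      = ∫ s : EuclideanSpace ℝ (Fin p), Real.exp (-(1 / 2) * ‖s‖ ^ 2)
        ∂(Measure.map (T : EuclideanSpace ℝ (Fin p) →ₗ[ℝ] EuclideanSpace ℝ (Fin p)) volume) := by
    rw [integral_map (by exact T.continuous.measurable.aemeasurable)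
      (Continuous.aestronglyMeasurable (by fun_prop))]
    refine integral_congr_ae (Eventually.of_forall fun s => ?_)
    simp only [ContinuousLinearMap.coe_coe, hsq]
  rw [h1, hmap, integral_smul_measure, GaussianFourier.integral_rexp_neg_mul_sq_norm one_half_pos,
    ENNReal.toReal_ofReal (abs_nonneg _), finrank_euclideanSpace_fin, ← hd, smul_eq_mul,
    Matrix.det_nonsing_inv, Ring.inverse_eq_inv', ← hdet,
    Real.sqrt_mul (by positivity), Real.sqrt_inv, Real.sqrt_sq_eq_abs, abs_inv, mul_comm]
  congr 1
  rw [Real.sqrt_eq_rpow, ← Real.rpow_natCast, ← Real.rpow_mul (by positivity)]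
  congr 1 <;> ring

theorem exp_div_integral_eq_gaussianDensity {p : ℕ} {H : Matrix (Fin p) (Fin p) ℝ}
    (hH : H.PosDef) (s : EuclideanSpace ℝ (Fin p)) :
    Real.exp (-(1 / 2) * (s.ofLp ⬝ᵥ H.mulVec s.ofLp)) /
      (∫ s : EuclideanSpace ℝ (Fin p), Real.exp (-(1 / 2) * (s.ofLp ⬝ᵥ H.mulVec s.ofLp)))
      = gaussianDensity 0 H⁻¹ s := by
  rw [integral_exp_neg_half_posDef hH, gaussianDensity, sub_zero,
    Matrix.nonsing_inv_nonsing_inv _ (isUnit_iff_ne_zero.2 hH.det_pos.ne'), div_eq_inv_mul]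

/-! ### The density of the rescaled posterior -/

/-- Change of variables `s = R (θ - c)` for a density. -/
theorem map_smul_sub_withDensity {p : ℕ} {w : EuclideanSpace ℝ (Fin p) → ENNReal}
    (hw : Measurable w) (c : EuclideanSpace ℝ (Fin p)) {R : ℝ} (hR : 0 < R) :
    (volume.withDensity w).map (fun θ => R • (θ - c)) =
      volume.withDensity fun s => ENNReal.ofReal ((R ^ p)⁻¹) * w (c + R⁻¹ • s) := by
  have hφ : Measurable fun θ : EuclideanSpace ℝ (Fin p) => R • (θ - c) := by fun_prop
  have hψ : Measurable fun s : EuclideanSpace ℝ (Fin p) => c + R⁻¹ • s := by fun_prop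
  have h2 : Measurable fun s => w (c + R⁻¹ • s) := hw.comp hψ
  ext A hA
  rw [Measure.map_apply hφ hA, withDensity_apply _ (hφ hA), withDensity_apply _ hA,
    ← lintegral_indicator (hφ hA), lintegral_const_mul _ h2, ← lintegral_indicator hA]
  set F : EuclideanSpace ℝ (Fin p) → ENNReal := A.indicator fun s => w (c + R⁻¹ • s) with hF
  have hFm : Measurable F := h2.indicator hA
  have h1 : ((fun θ => R • (θ - c)) ⁻¹' A).indicator w = fun θ => F (R • (θ - c)) := by
    ext θ
    by_cases hθ : R • (θ - c) ∈ A
    · rw [Set.indicator_of_mem (by exact hθ), hF, Set.indicator_of_mem hθ, smul_smul,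
        inv_mul_cancel₀ hR.ne', one_smul, add_sub_cancel]
    · rw [Set.indicator_of_notMem (by exact hθ), hF, Set.indicator_of_notMem hθ]
  rw [h1, lintegral_sub_right_eq_self (fun θ => F (R • θ)) c,
    ← lintegral_map hFm (measurable_const_smul R), Measure.map_addHaar_smul _ hR.ne',
    lintegral_smul_measure, finrank_euclideanSpace_fin, abs_of_pos (by positivity), smul_eq_mul]

section Posterior

variable {p : ℕ} {𝒳 : Type*} [MeasurableSpace 𝒳] {Θ : Set (EuclideanSpace ℝ (Fin p))}
  {S : ProbabilityMeasure 𝒳 → 𝒳 → ℝ} {P : EuclideanSpace ℝ (Fin p) → ProbabilityMeasure 𝒳}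
  {π : EuclideanSpace ℝ (Fin p) → ℝ}

/-- The rescaled posterior density is the local weight divided by its integral. The additive
constant `a` cancels. -/
theorem rescaledDensity_ae_eq (hΘ : MeasurableSet Θ) (hS : MeasurableScore Θ S P)
    (hπ : IsPriorDensity Θ π) {n : ℕ} (hn : 0 < n) (y : Fin n → 𝒳)
    {Q : EuclideanSpace ℝ (Fin p) → ℝ} {a : ℝ} (hQ : ∀ θ ∈ Θ, ∑ i, S (P θ) (y i) = a + Q θ) (c : EuclideanSpace ℝ (Fin p))
    (hint : Integrable (localWeight Θ π Q n c)) (hpos : 0 < ∫ s, localWeight Θ π Q n c s) :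
    IsProbabilityMeasure (posterior Θ S P π y) ∧
      rescaledDensity Θ S P π y c =ᵐ[volume]
        fun s => localWeight Θ π Q n c s / ∫ s, localWeight Θ π Q n c s := by
  set R := √(n : ℝ) with hRdef
  have hR : 0 < R := Real.sqrt_pos.2 (Nat.cast_pos.2 hn)
  set I := ∫ s, localWeight Θ π Q n c s with hI
  set w : EuclideanSpace ℝ (Fin p) → ENNReal :=
    Θ.indicator fun θ => ENNReal.ofReal (posteriorWeight S P π y θ) with hw
  have hsum : Measurable fun θ : Θ => ∑ i, S (P θ) (y i) :=
    Finset.measurable_sum _ fun i _ => hS.measurable_param (y i)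
  have hwR : Measurable (Θ.indicator (posteriorWeight S P π y)) :=
    measurable_indicator_of_subtype hΘ (hπ.measurable.mul hsum.neg.exp)
  have hw' : w = fun θ => ENNReal.ofReal (Θ.indicator (posteriorWeight S P π y) θ) := by
    ext θ
    by_cases hθ : θ ∈ Θ <;> simp [hw, hθ]
  have hwm : Measurable w := hw' ▸ hwR.ennreal_ofReal
  have hW0 : ∀ s, 0 ≤ localWeight Θ π Q n c s := fun s =>
    Set.indicator_nonneg (fun θ hθ => mul_nonneg (hπ.nonneg θ hθ) (Real.exp_pos _).le) _
  set k : ℝ := (R ^ p)⁻¹ * Real.exp (-a) with hk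
  have hk0 : 0 < k := by positivity
  have hdens : (fun s => ENNReal.ofReal ((R ^ p)⁻¹) * w (c + R⁻¹ • s))
      = fun s => ENNReal.ofReal (k * localWeight Θ π Q n c s) := by
    ext s
    rw [hw', ← ENNReal.ofReal_mul (by positivity), hk, mul_assoc]
    congr 2
    rw [localWeight, ← hRdef]
    by_cases hθ : c + R⁻¹ • s ∈ Θ
    · rw [Set.indicator_of_mem hθ, Set.indicator_of_mem hθ, posteriorWeight, hQ _ hθ, neg_add,
        Real.exp_add]
      ring
    · rw [Set.indicator_of_notMem hθ, Set.indicator_of_notMem hθ, mul_zero]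
  have hmap : (volume.withDensity w).map (fun θ => R • (θ - c)) =
      volume.withDensity fun s => ENNReal.ofReal (k * localWeight Θ π Q n c s) := by
    rw [map_smul_sub_withDensity hwm c hR, hdens]
  have hZ : ∫⁻ θ in Θ, ENNReal.ofReal (posteriorWeight S P π y θ) = ENNReal.ofReal (k * I) := by
    have h1 := congrArg (fun μ => μ Set.univ) hmap
    beta_reduce at h1
    rw [Measure.map_apply (by fun_prop) MeasurableSet.univ, Set.preimage_univ,
      withDensity_apply _ MeasurableSet.univ, withDensity_apply _ MeasurableSet.univ,
      Measure.restrict_univ, hw, lintegral_indicator hΘ] at h1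
    rw [h1, ← ofReal_integral_eq_lintegral_ofReal (hint.const_mul k)
      (Eventually.of_forall fun s => mul_nonneg hk0.le (hW0 s)), integral_const_mul]
  have hkI : 0 < k * I := mul_pos hk0 hpos
  have hpost : posterior Θ S P π y = (ENNReal.ofReal (k * I))⁻¹ • volume.withDensity w := by
    rw [posterior, hZ, hw, withDensity_indicator hΘ]
  have hne : ENNReal.ofReal (k * I) ≠ 0 := (ENNReal.ofReal_pos.2 hkI).ne'
  constructor
  · constructor
    rw [hpost, Measure.smul_apply, withDensity_apply _ MeasurableSet.univ, Measure.restrict_univ,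
      hw, lintegral_indicator hΘ, hZ, smul_eq_mul,
      ENNReal.inv_mul_cancel hne ENNReal.ofReal_ne_top]
  · have hWm : Measurable fun s => ENNReal.ofReal (k * localWeight Θ π Q n c s) := by
      rw [← hdens]
      exact (hwm.comp (by fun_prop)).const_mul _
    have hm2 : (posterior Θ S P π y).map (fun θ => R • (θ - c)) = volume.withDensity
        ((ENNReal.ofReal (k * I))⁻¹ • fun s => ENNReal.ofReal (k * localWeight Θ π Q n c s)) := by
      rw [hpost, Measure.map_smul, hmap, withDensity_smul _ hWm]
    have hrn := Measure.rnDeriv_withDensity (volume : Measure (EuclideanSpace ℝ (Fin p)))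
      (hWm.const_smul (ENNReal.ofReal (k * I))⁻¹)
    filter_upwards [hrn] with s hs
    rw [rescaledDensity, ← hRdef, hm2, hs, Pi.smul_apply, smul_eq_mul, ENNReal.toReal_mul,
      ENNReal.toReal_inv, ENNReal.toReal_ofReal hkI.le,
      ENNReal.toReal_ofReal (mul_nonneg hk0.le (hW0 s))]
    field_simp

end Posterior

/-! ### Measurable approximate minimizers -/

/-- The estimator is the first term of a dense sequence of the ball at which the total score is
within `1 / (n + 1)` of its minimum over the ball. Working with a countable set makes it measurable,
although the score is only assumed measurable in each variable separately. -/
theorem exists_measurable_approx_minimizer {p : ℕ} {𝒳 : Type*} [MeasurableSpace 𝒳]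
    {f : EuclideanSpace ℝ (Fin p) → 𝒳 → ℝ} {θs : EuclideanSpace ℝ (Fin p)} {ρ : ℝ} (hρ : 0 ≤ ρ)
    (hcont : ∀ y, ContinuousOn (fun θ => f θ y) (Metric.closedBall θs ρ))
    (hm : ∀ θ ∈ Metric.closedBall θs ρ, Measurable (f θ)) :
    ∃ θhat : (n : ℕ) → (Fin n → 𝒳) → EuclideanSpace ℝ (Fin p), (∀ n, Measurable (θhat n)) ∧
      (∀ n y, θhat n y ∈ Metric.closedBall θs ρ) ∧
      ∀ n y, ∀ θ ∈ Metric.closedBall θs ρ,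
        ∑ i, f (θhat n y) (y i) ≤ ∑ i, f θ (y i) + 1 / ((n : ℝ) + 1) := by
  classical
  have : Nonempty (Metric.closedBall θs ρ) := ⟨⟨θs, Metric.mem_closedBall_self hρ⟩⟩
  have : CompactSpace (Metric.closedBall θs ρ) :=
    isCompact_iff_compactSpace.1 (isCompact_closedBall θs ρ)
  obtain ⟨d, hd⟩ := TopologicalSpace.exists_dense_seq (Metric.closedBall θs ρ)
  have hF : ∀ (n : ℕ) (y : Fin n → 𝒳),
      Continuous fun θ : Metric.closedBall θs ρ => ∑ i, f θ (y i) := fun n y =>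
    continuous_finsetSum _ fun i _ => continuousOn_iff_continuous_domRestrict.1 (hcont (y i))
  have hex : ∀ (n : ℕ) (y : Fin n → 𝒳), ∃ k, ∀ j,
      ∑ i, f (d k) (y i) ≤ ∑ i, f (d j) (y i) + 1 / ((n : ℝ) + 1) := by
    intro n y
    obtain ⟨θm, -, hθm⟩ := isCompact_univ.exists_isMinOn Set.univ_nonempty (hF n y).continuousOn
    obtain ⟨k, hk⟩ := hd.exists_mem_open
      (isOpen_lt (hF n y) continuous_const : IsOpen {θ : Metric.closedBall θs ρ |
        ∑ i, f θ (y i) < ∑ i, f θm (y i) + 1 / ((n : ℝ) + 1)})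
      ⟨θm, by simp only [Set.mem_ofPred_eq, lt_add_iff_pos_right]; positivity⟩
    refine ⟨k, fun j => (le_of_lt hk).trans ?_⟩
    have := isMinOn_iff.1 hθm (d j) (Set.mem_univ _)
    linarith
  refine ⟨fun n y => d (Nat.find (hex n y)), fun n => ?_, fun n y => (d _).2,
    fun n y θ hθ => ?_⟩
  · have hmeas : ∀ k, Measurable fun y : Fin n → 𝒳 => ∑ i, f (d k) (y i) := fun k =>
      Finset.measurable_sum _ fun i _ => (hm _ (d k).2).comp (measurable_pi_apply i)
    have hfind : Measurable fun y : Fin n → 𝒳 => Nat.find (hex n y) := by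
      refine measurable_find _ fun k => ?_
      simp only [Set.ofPred_forall]
      exact MeasurableSet.iInter fun j => measurableSet_le (hmeas k) ((hmeas j).add_const _)
    exact (measurable_from_nat (f := fun k => (d k : EuclideanSpace ℝ (Fin p)))).comp hfind
  · have hle := hd.induction_on (p := fun θ : Metric.closedBall θs ρ =>
      ∑ i, f (d (Nat.find (hex n y))) (y i) ≤ ∑ i, f θ (y i) + 1 / ((n : ℝ) + 1)) ⟨θ, hθ⟩
      (isClosed_le continuous_const ((hF n y).add continuous_const)) (Nat.find_spec (hex n y))
    exact hle

/-! ### Asymptotic normality of the posterior -/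

/-- Separation makes approximate minimizers consistent, and then holds around them as well. -/
theorem SeparatesFrom.tendsto_of_approx_minimizer {V : Type*} [NormedAddCommGroup V]
    {L : ℕ → V → ℝ} {Θ : Set V} {θs : V} {c : ℝ} (h : SeparatesFrom L Θ θs c)
    (hc : Tendsto (fun n => L n θs) atTop (𝓝 c)) {u : ℕ → V} (huΘ : ∀ n, u n ∈ Θ)
    (hmin : ∀ n : ℕ, n * (L n (u n) - L n θs) ≤ 1) :
    Tendsto u atTop (𝓝 θs) ∧
      ∀ ε > 0, ∃ η > 0, ∀ᶠ n : ℕ in atTop, ∀ θ ∈ Θ, ε ≤ ‖θ - u n‖ →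
        n * η ≤ n * (L n θ - L n (u n)) := by
  have hval : ∀ η > 0, ∀ᶠ n in atTop, L n (u n) < c + η := by
    intro η hη
    filter_upwards [hc.eventually_lt_const (show c < c + η / 2 by linarith),
      (tendsto_natCast_atTop_atTop (R := ℝ)).eventually_gt_atTop (2 / η)] with n h1 h2
    have hn : (0 : ℝ) < n := lt_trans (by positivity) h2
    rw [div_lt_iff₀ hη] at h2
    by_contra hge
    have h3 : (n : ℝ) * (η / 2) ≤ n * (L n (u n) - L n θs) := by
      gcongr; linarith [not_lt.1 hge]
    linarith [hmin n]
  have hu : Tendsto u atTop (𝓝 θs) := by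
    rw [Metric.tendsto_nhds]
    intro ε hε
    obtain ⟨η, hη, hn⟩ := h ε hε
    filter_upwards [hn, hval η hη] with n h1 h2
    rw [dist_eq_norm]
    by_contra hge
    linarith [h1 _ (huΘ n) (not_lt.1 hge)]
  refine ⟨hu, fun ε hε => ?_⟩
  obtain ⟨η, hη, hn⟩ := h (ε / 2) (half_pos hε)
  refine ⟨η / 2, half_pos hη, ?_⟩
  filter_upwards [hn, hval (η / 2) (half_pos hη),
    hu.eventually (Metric.ball_mem_nhds θs (half_pos hε))] with n h1 h2 h3 θ hθ hθε
  rw [dist_eq_norm] at h3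
  have h4 : ε / 2 ≤ ‖θ - θs‖ := by
    have := norm_sub_le_norm_sub_add_norm_sub θ θs (u n)
    rw [norm_sub_rev θs] at this
    linarith
  gcongr
  linarith [h1 θ hθ h4]

section Normality

variable {p : ℕ} {𝒳 Ω : Type*} [MeasurableSpace 𝒳] {Y : ℕ → Ω → 𝒳}
  {Θ U : Set (EuclideanSpace ℝ (Fin p))} {S : ProbabilityMeasure 𝒳 → 𝒳 → ℝ}
  {P : EuclideanSpace ℝ (Fin p) → ProbabilityMeasure 𝒳} {P₀ : ProbabilityMeasure 𝒳}
  {π : EuclideanSpace ℝ (Fin p) → ℝ} {θs : EuclideanSpace ℝ (Fin p)} {G : 𝒳 → ℝ}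

theorem UniqueMinimizer.integral_grad_eq_zero (hmin : UniqueMinimizer Θ S P P₀ θs)
    (hreg : RegularScore (fun θ y => S (P θ) y) (P₀ : Measure 𝒳) U G) (hUΘ : U ⊆ Θ)
    (hs : θs ∈ U) : ∫ y, grad (fun θ y => S (P θ) y) θs y ∂(P₀ : Measure 𝒳) = 0 := by
  have hloc : IsLocalMin (fun θ => ∫ y, S (P θ) y ∂(P₀ : Measure 𝒳)) θs := by
    filter_upwards [hreg.isOpen.mem_nhds hs] with θ hθ
    rcases eq_or_ne θ θs with rfl | hne
    · exact le_rfl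
    · exact (hmin.lt θ (hUΘ hθ) hne).le
  exact hloc.hasFDerivAt_eq_zero (hreg.hasFDerivAt_integral hs)

theorem RegularScore.integral_hess_apply_self
    (hreg : RegularScore (fun θ y => S (P θ) y) (P₀ : Measure 𝒳) U G) (hs : θs ∈ U)
    (v : EuclideanSpace ℝ (Fin p)) :
    (∫ y, hess (fun θ y => S (P θ) y) θs y ∂(P₀ : Measure 𝒳)) v v =
      v.ofLp ⬝ᵥ (hessian (fun θ => expectedScore S (P θ) P₀) θs).mulVec v.ofLp := by
  set H₀ := ∫ y, hess (fun θ y => S (P θ) y) θs y ∂(P₀ : Measure 𝒳) with hH₀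
  have hent : ∀ j k, hessian (fun θ => expectedScore S (P θ) P₀) θs j k
      = H₀ (basisVec j) (basisVec k) := fun j k => hreg.hessian_integral hs j k
  rw [apply_eq_sum_basisVec H₀ v, sum_apply]
  simp only [dotProduct, Matrix.mulVec, hent]
  refine Finset.sum_congr rfl fun j _ => ?_
  rw [smul_apply, smul_eq_mul, apply_eq_sum_basisVec (H₀ (basisVec j)) v]
  congr 1
  exact Finset.sum_congr rfl fun k _ => by rw [smul_eq_mul, mul_comm]

theorem natCast_mul_sampleMean {𝒳 Ω : Type*} {Y : ℕ → Ω → 𝒳} (f : 𝒳 → ℝ) (n : ℕ) (ω : Ω) :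
    (n : ℝ) * sampleMean f (fun i => Y i ω) n = ∑ i, f (sample Y n ω i) := by
  rcases Nat.eq_zero_or_pos n with rfl | hn
  · simp
  · have : (n : ℝ) ≠ 0 := by positivity
    rw [sampleMean_eq_sum_sample]
    field_simp

/-- The pathwise statement: for a sequence of observations along which the empirical score has a
local expansion and is separated, the posterior centred at approximate minimizers is asymptotically
normal in total variation. -/
theorem LocalExpansion.tendsto_rescaledDensity (hΘ : MeasurableSet Θ) (hS : MeasurableScore Θ S P)
    (hπ : IsPriorDensity Θ π) (hcont : ContinuousWithinAt π Θ θs) (hπpos : 0 < π θs)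
    {g : ℕ → EuclideanSpace ℝ (Fin p) → EuclideanSpace ℝ (Fin p) →L[ℝ] ℝ}
    {H : ℕ → EuclideanSpace ℝ (Fin p) →
      EuclideanSpace ℝ (Fin p) →L[ℝ] EuclideanSpace ℝ (Fin p) →L[ℝ] ℝ}
    {κ : ℕ → ℝ} {r c κ₀ : ℝ}
    {H₀ : EuclideanSpace ℝ (Fin p) →L[ℝ] EuclideanSpace ℝ (Fin p) →L[ℝ] ℝ} {ω : Ω}
    (h : LocalExpansion (fun n θ => sampleMean (S (P θ)) (fun i => Y i ω) n) g H κ θs r c H₀ κ₀)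
    (hr : Metric.ball θs r ⊆ Θ)
    (hsep : SeparatesFrom (fun n θ => sampleMean (S (P θ)) (fun i => Y i ω) n) Θ θs c)
    {M : Matrix (Fin p) (Fin p) ℝ} (hM : M.PosDef)
    (hH₀ : ∀ v, H₀ v v = v.ofLp ⬝ᵥ M.mulVec v.ofLp) {ρ : ℝ} (hρ : 0 < ρ)
    {u : ℕ → EuclideanSpace ℝ (Fin p)} (huΘ : ∀ n, u n ∈ Θ)
    (hmin : ∀ n, ∀ θ ∈ Metric.closedBall θs ρ, ∑ i, S (P (u n)) (sample Y n ω i) ≤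
      ∑ i, S (P θ) (sample Y n ω i) + 1 / ((n : ℝ) + 1)) :
    Tendsto u atTop (𝓝 θs) ∧
    (∀ᶠ n in atTop, IsProbabilityMeasure (posterior Θ S P π (sample Y n ω))) ∧
    Tendsto (fun n => ∫⁻ s, ENNReal.ofReal
      |rescaledDensity Θ S P π (sample Y n ω) (u n) s - gaussianDensity 0 M⁻¹ s|)
      atTop (𝓝 0) := by
  set L : ℕ → EuclideanSpace ℝ (Fin p) → ℝ := fun n θ => sampleMean (S (P θ)) (fun i => Y i ω) n
    with hL
  have hmul : ∀ (n : ℕ) θ, (n : ℝ) * L n θ = ∑ i, S (P θ) (sample Y n ω i) := fun n θ =>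
    natCast_mul_sampleMean _ _ _
  have hmin' : ∀ n : ℕ, ∀ θ ∈ Metric.closedBall θs ρ,
      n * (L n (u n) - L n θ) ≤ 1 / ((n : ℝ) + 1) := by
    intro n θ hθ
    rw [mul_sub, hmul, hmul]
    linarith [hmin n θ hθ]
  obtain ⟨hu, hout⟩ := hsep.tendsto_of_approx_minimizer h.tendsto_value huΘ fun n =>
    (hmin' n θs (Metric.mem_closedBall_self hρ.le)).trans (by
      rw [div_le_one (by positivity)]; linarith [Nat.cast_nonneg (α := ℝ) n])
  refine ⟨hu, ?_⟩
  have hg := h.tendsto_sqrt_mul_norm_grad hu hρ tendsto_one_div_add_atTop_nhds_zero_nat hmin'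
  obtain ⟨lam, hlam, hcoer⟩ := exists_coercive_of_posDef hM
  obtain ⟨ε, hε, hgrow⟩ := h.exists_quadratic_growth hlam (fun v => (hH₀ v).symm ▸ hcoer v) hu
  set Q : ℕ → EuclideanSpace ℝ (Fin p) → ℝ := fun n θ => n * (L n θ - L n (u n)) with hQ
  have hQm : ∀ n, Measurable fun θ : Θ => Q n θ := fun n => by
    have h1 : Measurable fun θ : Θ => ∑ i, S (P θ) (sample Y n ω i) :=
      Finset.measurable_sum _ fun i _ => hS.measurable_param _
    have h2 : (fun θ : Θ => Q n θ) = fun θ : Θ => ∑ i, S (P θ) (sample Y n ω i) - n * L n (u n) :=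
      funext fun θ => by rw [hQ, ← hmul, ← mul_sub]
    rw [h2]
    exact h1.sub_const _
  have hgrow' : ∀ᶠ n : ℕ in atTop, ∀ v, ‖v‖ ≤ ε → u n + v ∈ Θ ∧
      lam / 4 * (n * ‖v‖ ^ 2) - √(n : ℝ) * ‖v‖ ≤ Q n (u n + v) := by
    filter_upwards [hgrow, hg.eventually_lt_const one_pos] with n h1 h2 v hv
    obtain ⟨hm, hle⟩ := h1 v hv
    refine ⟨hr hm, ?_⟩
    have h3 : (n : ℝ) * (‖g n (u n)‖ * ‖v‖) ≤ √(n : ℝ) * ‖v‖ := by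
      calc (n : ℝ) * (‖g n (u n)‖ * ‖v‖) = √(n : ℝ) * (√(n : ℝ) * ‖g n (u n)‖) * ‖v‖ := by
            rw [← mul_assoc √(n : ℝ), Real.mul_self_sqrt (Nat.cast_nonneg n), mul_assoc]
        _ ≤ √(n : ℝ) * 1 * ‖v‖ := by gcongr
        _ = _ := by rw [mul_one]
    have h4 := mul_le_mul_of_nonneg_left hle (Nat.cast_nonneg (α := ℝ) n)
    rw [mul_sub] at h4
    rw [hQ]
    linarith
  set B : EuclideanSpace ℝ (Fin p) → ℝ := fun s => 1 / 2 * H₀ s s with hB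
  obtain ⟨hBint, hWint, hWlim⟩ := tendsto_integral_abs_localWeight_sub hΘ hπ hcont hu hQm
    (show Continuous B by fun_prop) (fun s => h.tendsto_rescaled hu hg s) hε
    (show 0 < lam / 4 by positivity) hgrow' hout
  have hBeq : ∀ s, Real.exp (-B s) = Real.exp (-(1 / 2) * (s.ofLp ⬝ᵥ M.mulVec s.ofLp)) :=
    fun s => by rw [hB, ← hH₀, neg_mul]
  have hnorm : ∀ s, π θs * Real.exp (-B s) / (∫ s, π θs * Real.exp (-B s))
      = gaussianDensity 0 M⁻¹ s := fun s => by
    rw [integral_const_mul, mul_div_mul_left _ _ hπpos.ne', ← exp_div_integral_eq_gaussianDensity hM]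
    simp only [hBeq]
  have hIpos : 0 < ∫ s, π θs * Real.exp (-B s) := by
    rw [integral_const_mul]
    exact mul_pos hπpos (integral_exp_pos hBint)
  have hB0 : ∀ s, 0 ≤ π θs * Real.exp (-B s) := fun s => mul_nonneg hπpos.le (Real.exp_pos _).le
  obtain ⟨hWpos, hlim⟩ := tendsto_integral_abs_normalized_sub hWint (hBint.const_mul _) hB0 hIpos
    hWlim
  have hdens : ∀ᶠ n in atTop, IsProbabilityMeasure (posterior Θ S P π (sample Y n ω)) ∧
      rescaledDensity Θ S P π (sample Y n ω) (u n) =ᵐ[volume]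
        fun s => localWeight Θ π (Q n) n (u n) s / ∫ s, localWeight Θ π (Q n) n (u n) s := by
    filter_upwards [hWint, hWpos, eventually_gt_atTop 0] with n h1 h2 h3
    refine rescaledDensity_ae_eq hΘ hS hπ h3 _ (a := n * L n (u n)) (fun θ _ => ?_) _ h1 h2
    rw [← hmul, hQ]
    ring
  refine ⟨hdens.mono fun n hn => hn.1, ?_⟩
  have hlim' := ENNReal.tendsto_ofReal hlim
  rw [ENNReal.ofReal_zero] at hlim'
  refine hlim'.congr' ?_
  filter_upwards [hdens, hWint] with n hn hint
  have hi : Integrable fun s =>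
      |localWeight Θ π (Q n) n (u n) s / (∫ s, localWeight Θ π (Q n) n (u n) s) -
        π θs * Real.exp (-B s) / (∫ s, π θs * Real.exp (-B s))| :=
    ((hint.div_const _).sub ((hBint.const_mul _).div_const _)).abs
  rw [ofReal_integral_eq_lintegral_ofReal hi (Eventually.of_forall fun s => abs_nonneg _)]
  refine lintegral_congr_ae ?_
  filter_upwards [hn.2] with s hs
  rw [hs, hnorm]

end Normality

end ScoringRule

open ScoringRule in
theorem theorem1 {p : ℕ} {𝒳 Ω : Type*} [MeasurableSpace 𝒳] [MeasurableSpace Ω]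
    -- the observations are independent with law `P₀`
    (ν : Measure Ω) [IsProbabilityMeasure ν] (P₀ : ProbabilityMeasure 𝒳) (Y : ℕ → Ω → 𝒳)
    (hY_meas : ∀ i, Measurable (Y i)) (hY_law : ∀ i, ν.map (Y i) = (P₀ : Measure 𝒳))
    (hY_indep : iIndepFun Y ν)
    -- parameter space, model, scoring rule and prior density
    (Θ : Set (EuclideanSpace ℝ (Fin p))) (hΘ : MeasurableSet Θ)
    (P : EuclideanSpace ℝ (Fin p) → ProbabilityMeasure 𝒳)
    (S : ProbabilityMeasure 𝒳 → 𝒳 → ℝ) (hS : ScoringRule.MeasurableScore Θ S P)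
    (π : EuclideanSpace ℝ (Fin p) → ℝ) (hπ : ScoringRule.IsPriorDensity Θ π)
    (θs : EuclideanSpace ℝ (Fin p))
    -- the assumptions common to the three sets
    (hmin : ScoringRule.UniqueMinimizer Θ S P P₀ θs)
    (hπ_cont : ContinuousWithinAt π Θ θs) (hπ_pos : 0 < π θs)
    -- the three alternatives
    (hset :
      (∃ E, ScoringRule.RegularNeighborhood Θ S P P₀ θs E ∧
        ScoringRule.Separated ν Y Θ S P P₀ θs E) ∨
      ((∃ E, ScoringRule.RegularNeighborhood Θ S P P₀ θs E) ∧
        ∀ y, ConvexOn ℝ Θ fun θ => S (P θ) y) ∨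
      ScoringRule.RegularBoundedSpace Θ S P P₀ θs) :
    ∃ θhat : (n : ℕ) → (Fin n → 𝒳) → EuclideanSpace ℝ (Fin p),
      (∀ n, Measurable (θhat n)) ∧ (∀ n y, θhat n y ∈ Θ) ∧
      (∀ᵐ ω ∂ν, Tendsto (fun n => θhat n (ScoringRule.sample Y n ω)) atTop (𝓝 θs)) ∧
      (∀ᵐ ω ∂ν, ∀ᶠ n in atTop,
        IsProbabilityMeasure (ScoringRule.posterior Θ S P π (ScoringRule.sample Y n ω))) ∧
      ∀ᵐ ω ∂ν, Tendsto
        (fun n => ∫⁻ s, ENNReal.ofReal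
          |ScoringRule.rescaledDensity Θ S P π (ScoringRule.sample Y n ω)
              (θhat n (ScoringRule.sample Y n ω)) s -
            ScoringRule.gaussianDensity 0
              (ScoringRule.hessian (fun θ => ScoringRule.expectedScore S (P θ) P₀) θs)⁻¹ s|)
        atTop (𝓝 0) := by
  have hY : IsIIDSample Y ν (P₀ : Measure 𝒳) := ⟨hY_meas, hY_law, hY_indep⟩
  -- the three sets of assumptions are used only through regularity and separation
  obtain ⟨U, G, hUΘ, hs, hreg, hsep⟩ : ∃ (U : Set (EuclideanSpace ℝ (Fin p))) (G : 𝒳 → ℝ),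
      U ⊆ Θ ∧ θs ∈ U ∧ RegularScore (fun θ y => S (P θ) y) (P₀ : Measure 𝒳) U G ∧
      ∀ᵐ ω ∂ν, SeparatesFrom (fun n θ => sampleMean (S (P θ)) (fun i => Y i ω) n) Θ θs
        (expectedScore S (P θs) P₀) := by
    have hregE : ∀ E, E ⊆ Θ → IsOpen E → ThirdOrderRegular S P P₀ E →
        ∃ G, RegularScore (fun θ y => S (P θ) y) (P₀ : Measure 𝒳) E G := fun E hEΘ hE h =>
      h.exists_regularScore hE (fun θ hθ => hS.measurable_obs θ (hEΘ hθ))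
        (fun θ hθ => hmin.integrable θ (hEΘ hθ))
    rcases hset with ⟨E, hE, hsep⟩ | ⟨⟨E, hE⟩, hconv⟩ | hbdd
    · have hEΘ := subset_closure.trans hE.closure_subset
      obtain ⟨G, hG⟩ := hregE E hEΘ hE.isOpen hE.regular
      exact ⟨E, G, hEΘ, hE.mem, hG, ae_separatesFrom_of_separated hY hmin hEΘ hG hsep⟩
    · have hEΘ := subset_closure.trans hE.closure_subset
      obtain ⟨G, hG⟩ := hregE E hEΘ hE.isOpen hE.regular
      obtain ⟨r, hr, hrE⟩ := Metric.isOpen_iff.1 hE.isOpen θs hE.mem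
      obtain ⟨lam, hlam, hcoer⟩ := exists_coercive_of_posDef hmin.posDef
      refine ⟨E, G, hEΘ, hE.mem, hG, ?_⟩
      have : Nonempty 𝒳 := P₀.nonempty
      have hΘc : Convex ℝ Θ := (hconv (Classical.arbitrary 𝒳)).1
      filter_upwards [hG.exists_localExpansion hY hr hrE
        (hmin.integral_grad_eq_zero hG hEΘ hE.mem)] with ω hω
      exact hω.separatesFrom_of_convexOn hlam
        (fun v => (hG.integral_hess_apply_self hE.mem v).symm ▸ hcoer v) hmin.mem
        (fun n => convexOn_sampleMean hconv hΘc _ n)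
    · obtain ⟨G, hG⟩ := hregE Θ subset_rfl hbdd.isOpen hbdd.regular
      exact ⟨Θ, G, subset_rfl, hmin.mem, hG,
        ae_separatesFrom_of_regularBoundedSpace hY hmin hG hbdd⟩
  obtain ⟨r, hr, hrU⟩ := Metric.isOpen_iff.1 hreg.isOpen θs hs
  have hball : Metric.closedBall θs (r / 2) ⊆ U :=
    (Metric.closedBall_subset_ball (half_lt_self hr)).trans hrU
  obtain ⟨θhat, hmeas, hmem, happrox⟩ := exists_measurable_approx_minimizer
    (f := fun θ y => S (P θ) y) (half_pos hr).le
    (fun y => (hreg.contDiffOn y).continuousOn.mono hball)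
    (fun θ hθ => hreg.measurable θ (hball hθ))
  have hmain := (hsep.and (hreg.exists_localExpansion hY hr hrU
    (hmin.integral_grad_eq_zero hreg hUΘ hs))).mono fun ω h =>
      h.2.tendsto_rescaledDensity hΘ hS hπ hπ_cont hπ_pos (hrU.trans hUΘ) h.1 hmin.posDef
        (hreg.integral_hess_apply_self hs) (half_pos hr)
        (u := fun n => θhat n (sample Y n ω)) (fun n => hUΘ (hball (hmem n _)))
        (fun n θ hθ => happrox n _ θ hθ)
  exact ⟨θhat, hmeas, fun n y => hUΘ (hball (hmem n y)), hmain.mono fun ω h => h.1,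
    hmain.mono fun ω h => h.2.1, hmain.mono fun ω h => h.2.2⟩
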